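/- Let $p$ be an odd prime, let $e$ be a positive integer with $e\equiv 0\pmod 4$, let $q=p^e$, and let $i\in\{0,1\}$ be such that the Legendre symbol satisfies $\left(\frac{e}{p}\right)=(-1)^i$ (in particular $p\nmid e$). Let $\mathrm{Tr}:\mathbb{F}_q\to\mathbb{F}_p$ be the trace, let $C_0$ and $C_1$ be the sets of nonzero squares and of non-squares in $\mathbb{F}_p^*$, and let $\eta$ be the quadratic character of $\mathbb{F}_p$. Put $$D_i=\{x\in\mathbb{F}_q:\mathrm{Tr}(x^{p+1}-x)\in C_i\},\qquad \mathcal{C}_{D_i}=\{(\mathrm{Tr}(ax))_{x\in D_i}:a\in\mathbb{F}_q\}\subseteq\mathbb{F}_p^{D_i}.$$ Then the linear code $\mathcal{C}_{D_i}$ over $\mathbb{F}_p$ has length $$|D_i|=\frac{p-1}{2}p^{e-1}-\frac{1+\eta(-1)p}{2}p^{e/2},$$ dimension $e$, and at most $6$ distinct nonzero Hamming weights. Its weight distribution is as follows, where rows with the same weight (this happens only for $p=3$) are merged by adding their multiplicities, and no codeword has a weight that is not listed. If $p\equiv 1\pmod 4$ (equivalently $\left(\frac{-e}{p}\right)=(-1)^i$):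 $$\begin{array}{ll} \text{Weight} & \text{Multiplicity}\\ 0 & 1\\ \frac{(p-1)^2}{2}p^{e-2}-\frac{p^2-1}{2}p^{\frac e2-1} & p^e-p^{e-2}\\ \frac{(p-1)^2}{2}p^{e-2} & p^{e-4}-1\\ \frac{(p-1)^2}{2}p^{e-2}-\frac{p+1}{2}p^{\frac e2} & \frac{p^2-1}{2}p^{e-4}-(p-1)p^{\frac e2-2}\\ \frac{(p-1)^2}{2}p^{e-2}-\frac{p+3}{2}p^{\frac e2} & \frac{(p-1)(p-3)}{4}p^{e-4}-\frac{(p-1)(p-3)}{4}p^{\frac e2-2}\\ \frac{(p-1)^2}{2}p^{e-2}-\frac{p-1}{2}p^{\frac e2} & \frac{p^2-1}{4}p^{e-4}+\frac{p^2-1}{4}p^{\frac e2-2}\\ \frac{(p-1)^2}{2}p^{e-2}-p^{\frac e2} & (p-1)p^{e-4} \end{array}$$ If $p\equiv 3\pmod 4$ (equivalently $\left(\frac{-e}{p}\right)=(-1)^{1-i}$): $$\begin{array}{ll} \text{Weight} & \text{Multiplicity}\\ 0 & 1\\ \frac{(p-1)^2}{2}p^{e-2}+\frac{(p-1)^2}{2}p^{\frac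 e2-1} & p^e-p^{e-2}\\ \frac{(p-1)^2}{2}p^{e-2} & p^{e-3}-1\\ \frac{(p-1)^2}{2}p^{e-2}+\frac{p-1}{2}p^{\frac e2} & \frac{p^2-1}{2}p^{e-4}\\ \frac{(p-1)^2}{2}p^{e-2}+\frac{p-3}{2}p^{\frac e2} & \frac{(p-1)^2}{4}p^{e-4}-\frac{(p-1)^2}{4}p^{\frac e2-2}\\ \frac{(p-1)^2}{2}p^{e-2}+\frac{p+1}{2}p^{\frac e2} & \frac{(p-1)^2}{4}p^{e-4}+\frac{(p-1)^2}{4}p^{\frac e2-2} \end{array}$$ -/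

import Mathlib

/-- The cyclotomic classes of order two in `𝔽_p^*`: `C_0` is the set of nonzero squares,
`C_1` the set of non-squares. -/
def cyclotomicClass (p : ℕ) (i : Fin 2) : Set (ZMod p) :=
  {y | y ≠ 0 ∧ (IsSquare y ↔ i = 0)}

open Classical in
/-- The defining set `D_i = {x ∈ 𝔽_q : Tr(x^(p+1) - x) ∈ C_i}`. -/
noncomputable def definingSet (p : ℕ) (F : Type*) [Field F] [Fintype F] [Algebra (ZMod p) F]
    (i : Fin 2) : Finset F :=
  {x : F | Algebra.trace (ZMod p) F (x ^ (p + 1) - x) ∈ cyclotomicClass p i}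

/-- The encoding map `a ↦ (Tr(a x))_{x ∈ D}`. -/
noncomputable def codewordMap (p : ℕ) {F : Type*} [Field F] [Algebra (ZMod p) F]
    (D : Finset F) : F →ₗ[ZMod p] (D → ZMod p) :=
  LinearMap.pi fun x => Algebra.trace (ZMod p) F ∘ₗ LinearMap.mulRight (ZMod p) (x : F)

/-- The linear code `C_D = {(Tr(a x))_{x ∈ D} : a ∈ 𝔽_q}`, of length `|D|`. -/
noncomputable def traceCode (p : ℕ) {F : Type*} [Field F] [Algebra (ZMod p) F]
    (D : Finset F) : Submodule (ZMod p) (D → ZMod p) :=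
  LinearMap.range (codewordMap p D)

/-- The number of codewords of Hamming weight `w` in the code `C`. The weight `w` is allowed to
be any rational number (the count is zero unless `w` is a natural number). -/
noncomputable def weightCount {p : ℕ} {ι : Type*} [Fintype ι] (C : Submodule (ZMod p) (ι → ZMod p))
    (w : ℚ) : ℕ :=
  {c : ι → ZMod p | c ∈ C ∧ (hammingNorm c : ℚ) = w}.ncard

/-- `C` has the weight distribution given by the table `T` of pairs (weight, multiplicity): for
every `w`, the number of codewords of weight `w` is the total multiplicity of the rows of weight
`w` (it is zero if there is no such row). -/
def HasWeightTable {p : ℕ} {ι : Type*} [Fintype ι] (C : Submodule (ZMod p) (ι → ZMod p))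
    (T : List (ℚ × ℚ)) : Prop :=
  ∀ w : ℚ, (weightCount C w : ℚ) = (T.map fun r => if r.1 = w then r.2 else 0).sum

/-- The number of nonzero weights of the code `C`, namely `|{1 ≤ w ≤ n : A_w ≠ 0}|`, where `n` is
the length of `C` and `A_w` the number of codewords of weight `w`. -/
noncomputable def numNonzeroWeights {p : ℕ} {ι : Type*} [Fintype ι]
    (C : Submodule (ZMod p) (ι → ZMod p)) : ℕ :=
  ((Finset.Icc 1 (Fintype.card ι)).filter fun w : ℕ => weightCount C (w : ℚ) ≠ 0).card

/-- The table for `p ≡ 1 mod 4`. -/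
def tableOne (p e : ℕ) : List (ℚ × ℚ) :=
  [(0, 1),
   (((p : ℚ) - 1) ^ 2 / 2 * (p : ℚ) ^ (e - 2) - ((p : ℚ) ^ 2 - 1) / 2 * (p : ℚ) ^ (e / 2 - 1),
    (p : ℚ) ^ e - (p : ℚ) ^ (e - 2)),
   (((p : ℚ) - 1) ^ 2 / 2 * (p : ℚ) ^ (e - 2),
    (p : ℚ) ^ (e - 4) - 1),
   (((p : ℚ) - 1) ^ 2 / 2 * (p : ℚ) ^ (e - 2) - ((p : ℚ) + 1) / 2 * (p : ℚ) ^ (e / 2),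
    ((p : ℚ) ^ 2 - 1) / 2 * (p : ℚ) ^ (e - 4) - ((p : ℚ) - 1) * (p : ℚ) ^ (e / 2 - 2)),
   (((p : ℚ) - 1) ^ 2 / 2 * (p : ℚ) ^ (e - 2) - ((p : ℚ) + 3) / 2 * (p : ℚ) ^ (e / 2),
    ((p : ℚ) - 1) * ((p : ℚ) - 3) / 4 * (p : ℚ) ^ (e - 4)
      - ((p : ℚ) - 1) * ((p : ℚ) - 3) / 4 * (p : ℚ) ^ (e / 2 - 2)),
   (((p : ℚ) - 1) ^ 2 / 2 * (p : ℚ) ^ (e - 2) - ((p : ℚ) - 1) / 2 * (p : ℚ) ^ (e / 2),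
    ((p : ℚ) ^ 2 - 1) / 4 * (p : ℚ) ^ (e - 4)
      + ((p : ℚ) ^ 2 - 1) / 4 * (p : ℚ) ^ (e / 2 - 2)),
   (((p : ℚ) - 1) ^ 2 / 2 * (p : ℚ) ^ (e - 2) - (p : ℚ) ^ (e / 2),
    ((p : ℚ) - 1) * (p : ℚ) ^ (e - 4))]

/-- The table for `p ≡ 3 mod 4`. -/
def tableThree (p e : ℕ) : List (ℚ × ℚ) :=
  [(0, 1),
   (((p : ℚ) - 1) ^ 2 / 2 * (p : ℚ) ^ (e - 2) + ((p : ℚ) - 1) ^ 2 / 2 * (p : ℚ) ^ (e / 2 - 1),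
    (p : ℚ) ^ e - (p : ℚ) ^ (e - 2)),
   (((p : ℚ) - 1) ^ 2 / 2 * (p : ℚ) ^ (e - 2),
    (p : ℚ) ^ (e - 3) - 1),
   (((p : ℚ) - 1) ^ 2 / 2 * (p : ℚ) ^ (e - 2) + ((p : ℚ) - 1) / 2 * (p : ℚ) ^ (e / 2),
    ((p : ℚ) ^ 2 - 1) / 2 * (p : ℚ) ^ (e - 4)),
   (((p : ℚ) - 1) ^ 2 / 2 * (p : ℚ) ^ (e - 2) + ((p : ℚ) - 3) / 2 * (p : ℚ) ^ (e / 2),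
    ((p : ℚ) - 1) ^ 2 / 4 * (p : ℚ) ^ (e - 4)
      - ((p : ℚ) - 1) ^ 2 / 4 * (p : ℚ) ^ (e / 2 - 2)),
   (((p : ℚ) - 1) ^ 2 / 2 * (p : ℚ) ^ (e - 2) + ((p : ℚ) + 1) / 2 * (p : ℚ) ^ (e / 2),
    ((p : ℚ) - 1) ^ 2 / 4 * (p : ℚ) ^ (e - 4)
      + ((p : ℚ) - 1) ^ 2 / 4 * (p : ℚ) ^ (e / 2 - 2))]

/-! Write `k` for 𝔽_p, m = e/2, Q(x) = Tr(x^(p+1)), a quadratic form on 𝔽_q, and B for its polar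
form. As B(x, y) = Tr((x^(p²) + x) y^p), the radical is the kernel of x^(p²) + x, which has p²
elements because 4 ∣ e. Every t ≠ 0 in `k` is a (p+1)-th power c^(p+1) in 𝔽_q and Q(cx) = tQ(x), so
the nonzero values of Q are equidistributed and all sums ∑ ψ(zQ(u)), z ≠ 0, equal one integer S with
S² = p^(e+2). Multiplication by (p+1)-th roots of unity forces S ≡ 1 mod p+1. As m+1 is odd, S =
-p^(m+1) (`sum_addChar_hermitianTraceForm`).

The linear term is Tr(x) = B(h, x) with h = 1/2, and Q(h) = e/4 has quadratic character (e/p) =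
(-1)^i. Completing the square, x = u + h, turns the condition on x into η(Q(u) - Q(h)) = η(Q(h)).

Codewords correspond to functionals f = Tr(a·). If f does not vanish on the radical, then f is
equidistributed on D, a union of cosets of the radical; there are p^e - p^(e-2) such f. Otherwise f
= B(γ, ·), and the joint distribution of Q and B(γ, ·) (`card_quadraticForm_eq_and_polar_eq`)
reduces the weight to the number of v at which Q(γ)v² + B(h,γ)v + Q(h) has the character of -Q(h).
This depends only on the pair (Q(γ), B(h,γ)), whose distribution is the same lemma with γ = h. What
remains is a sum over pairs of coefficients, governed by the character of the discriminant
(`sum_quadraticCharCount`).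

Weight distributions are expressed as sums of an arbitrary test function g over the weights, so that
coinciding weights need no case distinction. -/

open Finset

/-! ### Sums of the quadratic character over quadratic polynomials -/

section QuadraticCharSums

variable {k : Type*} [Field k] [Fintype k] [DecidableEq k]

theorem card_filter_mul_eq {c : k} (hc : c ≠ 0) :
    (#{z : k × k | z.1 * z.2 = c} : ℤ) = Fintype.card k - 1 := by
  have h : #{z : k × k | z.1 * z.2 = c} = #((univ : Finset k).erase 0) := by
    refine Finset.card_bij' (fun z _ => z.1) (fun x _ => (x, x⁻¹ * c)) ?_ ?_ ?_ ?_
    · intro z hz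
      simp only [mem_filter, mem_univ, true_and] at hz
      simp only [mem_erase, mem_univ, and_true]
      rintro h0
      exact hc (by rw [← hz, h0, zero_mul])
    · intro x hx
      simp only [mem_erase, mem_univ, and_true] at hx
      simp [mul_inv_cancel_left₀ hx]
    · intro z hz
      simp only [mem_filter, mem_univ, true_and] at hz
      have h0 : z.1 ≠ 0 := fun h0 => hc (by rw [← hz, h0, zero_mul])
      ext <;> simp [← hz, inv_mul_cancel_left₀ h0]
    · intro x hx
      rfl
  rw [h, card_erase_of_mem (mem_univ _), card_univ, Nat.cast_sub Fintype.card_pos, Nat.cast_one]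

theorem card_filter_sq_eq (hk : ringChar k ≠ 2) (a : k) :
    (#{x : k | x ^ 2 = a} : ℤ) = quadraticChar k a + 1 := by
  rw [← quadraticChar_card_sqrts hk a]
  congr 2
  ext x
  simp

/-- Adding 1 to each term counts the points of y² = x² - c, a hyperbola, which becomes z₁z₂ = c in
the coordinates x - y, x + y. -/
theorem sum_quadraticChar_sq_sub (hk : ringChar k ≠ 2) {c : k} (hc : c ≠ 0) :
    ∑ x : k, quadraticChar k (x ^ 2 - c) = -1 := by
  have h2 : (2 : k) ≠ 0 := Ring.two_ne_zero hk
  have h1 : ∑ x : k, (quadraticChar k (x ^ 2 - c) + 1)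
      = (#{z : k × k | z.2 ^ 2 = z.1 ^ 2 - c} : ℤ) := by
    simp_rw [← card_filter_sq_eq hk, card_filter, Nat.cast_sum]
    rw [Fintype.sum_prod_type]
  have h3 : #{z : k × k | z.2 ^ 2 = z.1 ^ 2 - c} = #{z : k × k | z.1 * z.2 = c} := by
    refine Finset.card_bij' (fun z _ => (z.1 - z.2, z.1 + z.2))
      (fun z _ => ((z.1 + z.2) / 2, (z.2 - z.1) / 2)) ?_ ?_ ?_ ?_
    · intro z hz
      simp only [mem_filter, mem_univ, true_and] at hz ⊢
      linear_combination -hz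
    · intro z hz
      simp only [mem_filter, mem_univ, true_and] at hz ⊢
      field_simp
      linear_combination -4 * hz
    · intro z hz
      ext <;> field_simp <;> ring
    · intro z hz
      ext <;> field_simp <;> ring
  rw [h3, card_filter_mul_eq hc, sum_add_distrib] at h1
  rw [sum_const, card_univ, nsmul_eq_mul, mul_one] at h1
  linarith

theorem sum_quadraticChar_sq_sub_sq (hk : ringChar k ≠ 2) (c : k) :
    ∑ x : k, (quadraticChar k (x ^ 2 - c)) ^ 2 = Fintype.card k - 1 - quadraticChar k c := by
  have h : ∀ x : k, (quadraticChar k (x ^ 2 - c)) ^ 2 = 1 - if x ^ 2 = c then 1 else 0 := by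
    intro x
    split_ifs with h
    · simp [h]
    · rw [quadraticChar_sq_one (sub_ne_zero.mpr h)]
      simp
  simp_rw [h, sum_sub_distrib, sum_boole, card_filter_sq_eq hk]
  simp
  ring

/-- Lagrange interpolation at 0, 1, -1: the sum of any function of the character follows from the
first two moments of the character. -/
theorem apply_quadraticChar (F : ℤ → ℚ) (a : k) :
    F (quadraticChar k a) = F 0 * (1 - (quadraticChar k a : ℚ) ^ 2)
      + F 1 * (((quadraticChar k a : ℚ) ^ 2 + quadraticChar k a) / 2)
      + F (-1) * (((quadraticChar k a : ℚ) ^ 2 - quadraticChar k a) / 2) := by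
  by_cases h : a = 0
  · simp [h]
  · rcases quadraticChar_dichotomy h with h | h <;> simp [h]

/-- The distribution of the quadratic character on the values of `x ^ 2 - c`. -/
theorem sum_apply_quadraticChar_sq_sub (hk : ringChar k ≠ 2) {c : k} (hc : c ≠ 0) (F : ℤ → ℚ) :
    ∑ x : k, F (quadraticChar k (x ^ 2 - c)) = F 0 * (1 + quadraticChar k c)
      + F 1 * (Fintype.card k - 2 - quadraticChar k c) / 2
      + F (-1) * (Fintype.card k - quadraticChar k c) / 2 := by
  have h1 : ∑ x : k, (quadraticChar k (x ^ 2 - c) : ℚ) = -1 := by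
    exact_mod_cast sum_quadraticChar_sq_sub hk hc
  have h2 : ∑ x : k, (quadraticChar k (x ^ 2 - c) : ℚ) ^ 2
      = Fintype.card k - 1 - quadraticChar k c := by
    exact_mod_cast sum_quadraticChar_sq_sub_sq hk c
  simp_rw [apply_quadraticChar F, sum_add_distrib, ← mul_sum, ← sum_div, sum_add_distrib,
    sum_sub_distrib, h1, h2]
  simp
  ring

/-- Nonzero squares and non-squares are equally many. -/
theorem sum_apply_quadraticChar_mul (hk : ringChar k ≠ 2) {c : k} (hc : c ≠ 0) (F : ℤ → ℚ) :
    ∑ x ∈ univ.erase (0 : k), F (quadraticChar k (c * x))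
      = (Fintype.card k - 1) / 2 * (F 1 + F (-1)) := by
  have h0 : ∑ x : k, F (quadraticChar k (c * x)) = ∑ x : k, F (quadraticChar k x) :=
    Fintype.sum_equiv (Equiv.mulLeft₀ c hc) _ _ fun _ => rfl
  have h1 : ∑ x : k, (quadraticChar k x : ℚ) = 0 := by
    exact_mod_cast quadraticChar_sum_zero hk
  have h2 : ∑ x : k, (quadraticChar k x : ℚ) ^ 2 = Fintype.card k - 1 := by
    have h : ∀ x : k, (quadraticChar k x : ℚ) ^ 2 = 1 - if x = 0 then 1 else 0 := by
      intro x
      split_ifs with h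
      · simp [h]
      · have := quadraticChar_sq_one h
        rw [sub_zero]
        exact_mod_cast this
    simp_rw [h, sum_sub_distrib]
    simp
  have h3 := sum_erase_eq_sub (s := univ) (f := fun x : k => F (quadraticChar k (c * x)))
    (mem_univ 0)
  rw [h3, h0]
  simp_rw [apply_quadraticChar F, sum_add_distrib, ← mul_sum, ← sum_div, sum_add_distrib,
    sum_sub_distrib, h1, h2]
  simp
  ring

theorem quadraticChar_quadratic (hk : ringChar k ≠ 2) {a : k} (ha : a ≠ 0) (b c v : k) :
    quadraticChar k (a * v ^ 2 + b * v + c)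
      = quadraticChar k a * quadraticChar k ((2 * a * v + b) ^ 2 - (b ^ 2 - 4 * a * c)) := by
  have h2 : (2 : k) ≠ 0 := Ring.two_ne_zero hk
  have h : (2 * a * v + b) ^ 2 - (b ^ 2 - 4 * a * c)
      = 2 ^ 2 * (a * (a * v ^ 2 + b * v + c)) := by ring
  rw [h, map_mul, quadraticChar_sq_one' h2, one_mul, map_mul, ← mul_assoc, ← sq,
    quadraticChar_sq_one ha, one_mul]

theorem sum_comp_affine {k : Type*} [Field k] [Fintype k] {a : k} (ha : a ≠ 0) (b : k)
    {M : Type*} [AddCommMonoid M] (f : k → M) :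
    ∑ v, f (a * v + b) = ∑ v, f v :=
  Fintype.sum_equiv ((Equiv.mulLeft₀ a ha).trans (Equiv.addRight b)) _ _ fun _ => rfl

theorem card_roots_quadratic (hk : ringChar k ≠ 2) {a : k} (ha : a ≠ 0) (b c : k) :
    (#{v : k | a * v ^ 2 + b * v + c = 0} : ℤ) = quadraticChar k (b ^ 2 - 4 * a * c) + 1 := by
  have h2 : (2 : k) ≠ 0 := Ring.two_ne_zero hk
  rw [← card_filter_sq_eq hk, card_filter, card_filter,
    ← sum_comp_affine (mul_ne_zero h2 ha) b
      (fun x => if x ^ 2 = b ^ 2 - 4 * a * c then 1 else 0)]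
  congr 1
  refine sum_congr rfl fun v _ => if_congr ?_ rfl rfl
  have h : (2 * a * v + b) ^ 2 - (b ^ 2 - 4 * a * c)
      = 2 ^ 2 * a * (a * v ^ 2 + b * v + c) := by ring
  rw [← sub_eq_zero (b := b ^ 2 - 4 * a * c), h]
  simp [ha, h2]

/-- The number of `v` at which a quadratic polynomial takes a given nonzero value of the quadratic
character. -/
theorem card_quadraticChar_quadratic_eq (hk : ringChar k ≠ 2) {a : k} (ha : a ≠ 0) (b c : k)
    (hd : b ^ 2 - 4 * a * c ≠ 0) {d : k} (hd0 : d ≠ 0) :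
    (#{v : k | quadraticChar k (a * v ^ 2 + b * v + c) = quadraticChar k d} : ℚ)
      = (Fintype.card k - 1 - quadraticChar k (b ^ 2 - 4 * a * c)
          - quadraticChar k a * quadraticChar k d) / 2 := by
  have h2 : (2 : k) ≠ 0 := Ring.two_ne_zero hk
  simp_rw [card_filter, quadraticChar_quadratic hk ha b c]
  push_cast
  rw [sum_comp_affine (mul_ne_zero h2 ha) b (fun x => if quadraticChar k a *
    quadraticChar k (x ^ 2 - (b ^ 2 - 4 * a * c)) = quadraticChar k d then (1 : ℚ) else 0),
    sum_apply_quadraticChar_sq_sub hk hd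
      (fun y => if quadraticChar k a * y = quadraticChar k d then (1 : ℚ) else 0)]
  rcases quadraticChar_dichotomy ha with h | h <;>
  rcases quadraticChar_dichotomy hd0 with h' | h' <;> norm_num [h, h'] <;> ring

end QuadraticCharSums

/-! ### Exponential sums and value distribution of quadratic forms -/

section QuadraticFormCounts

variable {k : Type*} [Field k] [Fintype k] [DecidableEq k] {V : Type*} [AddCommGroup V]
  [Module k V] [Fintype V] (Q : QuadraticForm k V) {ψ : AddChar k ℂ}

theorem sum_addChar_mul (hψ : ψ.IsPrimitive) (x : k) :
    ∑ z, ψ (z * x) = if x = 0 then (Fintype.card k : ℂ) else 0 := by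
  rw [AddChar.sum_mulShift x hψ]
  split_ifs <;> simp

theorem sum_erase_addChar_mul (hψ : ψ.IsPrimitive) (x : k) :
    ∑ z ∈ univ.erase 0, ψ (z * x) = if x = 0 then (Fintype.card k : ℂ) - 1 else -1 := by
  rw [sum_erase_eq_sub (mem_univ _), sum_addChar_mul hψ]
  split_ifs <;> simp

/-- Nontrivial linear functionals are equidistributed. -/
theorem sum_comp_linearMap {f : V →ₗ[k] k} (hf : f ≠ 0) (g : k → ℂ) :
    (Fintype.card k : ℂ) * ∑ u, g (f u) = Fintype.card V * ∑ x, g x := by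
  obtain ⟨v, hv⟩ : ∃ v, f v = 1 := by
    obtain ⟨w, hw⟩ : ∃ w, f w ≠ 0 := by
      by_contra! h
      exact hf (LinearMap.ext h)
    exact ⟨(f w)⁻¹ • w, by simp [hw]⟩
  -- Translating by x • v shifts the value of f by x; averaging over x makes the argument of g run
  -- over all of `k`.
  have h : ∀ x : k, ∑ u, g (f u) = ∑ u, g (f u + x) := fun x => by
    refine (Fintype.sum_equiv (Equiv.addRight (x • v)) _ _ fun u => ?_).symm
    simp [hv]
  have h' : ∑ x : k, ∑ u, g (f u) = ∑ x : k, ∑ u, g (f u + x) := sum_congr rfl fun x _ => h x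
  rw [sum_comm (s := univ) (t := univ) (f := fun x u => g (f u + x))] at h'
  rw [sum_const, card_univ, nsmul_eq_mul] at h'
  rw [h', ← nsmul_eq_mul, ← card_univ, ← sum_const]
  exact sum_congr rfl fun u _ => Fintype.sum_equiv (Equiv.addLeft (f u)) _ _ fun _ => rfl

theorem sum_addChar_linearMap (hψ : ψ.IsPrimitive) (f : V →ₗ[k] k) [Decidable (f = 0)] :
    ∑ u, ψ (f u) = if f = 0 then (Fintype.card V : ℂ) else 0 := by
  split_ifs with hf
  · simp [hf]
  · have h := sum_comp_linearMap hf (fun x => ψ x)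
    have h0 : ∑ x, ψ x = 0 := by simpa using sum_addChar_mul hψ 1
    rw [h0, mul_zero] at h
    exact (mul_eq_zero.mp h).resolve_left (by simp)

theorem QuadraticMap.map_add_smul {k V : Type*} [Field k] [AddCommGroup V] [Module k V]
    (Q : QuadraticForm k V) (u γ : V) (v : k) :
    Q (u + v • γ) = Q u + v * Q.polarBilin γ u + v ^ 2 * Q γ := by
  rw [QuadraticMap.map_add Q, QuadraticMap.map_smul, QuadraticMap.polar_smul_right,
    QuadraticMap.polar_comm]
  simp only [smul_eq_mul, polarBilin_apply_apply]
  ring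

variable {S : ℂ}

/-- The square of the exponential sum of a quadratic form. -/
theorem sq_sum_addChar_quadraticForm (hk : ringChar k ≠ 2) (hψ : ψ.IsPrimitive)
    (hS : ∀ z : k, z ≠ 0 → ∑ u, ψ (z * Q u) = S) :
    S ^ 2 = Fintype.card V * Nat.card (LinearMap.ker Q.polarBilin) := by
  classical
  -- Equality of the sums at 1 and -1 makes S² a sum times its conjugate; replacing x by x + y in
  -- the product then cancels Q(y) and leaves a character of y.
  have h1 : S = ∑ u, ψ (Q u) := by simpa using (hS 1 one_ne_zero).symm
  have h2 : S = ∑ u, ψ (-Q u) := by simpa using (hS (-1) (by simp)).symm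
  have hQ : ∀ x, Q.polarBilin x = 0 → Q x = 0 := fun x hx => by
    have h := QuadraticMap.polar_self Q x
    rw [← QuadraticMap.polarBilin_apply_apply, hx] at h
    simpa [Ring.two_ne_zero hk] using h
  calc S ^ 2 = (∑ y, ψ (-Q y)) * ∑ u, ψ (Q u) := by rw [← h1, ← h2, sq]
    _ = ∑ y, ∑ x, ψ (Q x) * ψ (Q.polarBilin x y) := by
      rw [sum_mul]
      refine sum_congr rfl fun y _ => ?_
      rw [mul_sum, ← Equiv.sum_comp (Equiv.addRight y)]
      refine sum_congr rfl fun x _ => ?_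
      rw [← AddChar.map_add_eq_mul, ← AddChar.map_add_eq_mul, Equiv.coe_addRight,
        QuadraticMap.map_add Q, QuadraticMap.polarBilin_apply_apply]
      congr 1
      ring
    _ = ∑ x, ψ (Q x) * ∑ y, ψ (Q.polarBilin x y) := by
      rw [sum_comm]
      simp_rw [mul_sum]
    _ = ∑ x, if Q.polarBilin x = 0 then (Fintype.card V : ℂ) else 0 := by
      refine sum_congr rfl fun x _ => ?_
      rw [sum_addChar_linearMap hψ]
      split_ifs with hx
      · simp [hQ x hx]
      · simp
    _ = _ := by
      rw [← sum_filter, sum_const, nsmul_eq_mul, mul_comm]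
      congr 2
      rw [Nat.card_eq_fintype_card, Fintype.card_subtype]
      simp only [LinearMap.mem_ker]

/-- Orthogonality of characters: z = 0 contributes |V|, and each z ≠ 0 contributes S times ψ(-zt).
-/
theorem card_quadraticForm_eq (hψ : ψ.IsPrimitive)
    (hS : ∀ z : k, z ≠ 0 → ∑ u, ψ (z * Q u) = S) (t : k) :
    (Fintype.card k : ℂ) * #{u | Q u = t}
      = Fintype.card V + S * (if t = 0 then (Fintype.card k : ℂ) - 1 else -1) := by
  have h : ∀ u, (Fintype.card k : ℂ) * (if Q u = t then 1 else 0) = ∑ z, ψ (z * (Q u - t)) := by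
    intro u
    rw [sum_addChar_mul hψ]
    simp [sub_eq_zero]
  rw [card_filter, Nat.cast_sum, mul_sum]
  push_cast
  simp_rw [h]
  rw [sum_comm, ← add_sum_erase _ _ (mem_univ 0)]
  congr 1
  · simp
  · have h2 : ∀ z ∈ univ.erase (0 : k), ∑ u, ψ (z * (Q u - t)) = S * ψ (z * -t) := by
      intro z hz
      rw [← hS z (ne_of_mem_erase hz), sum_mul]
      refine sum_congr rfl fun u _ => ?_
      rw [← AddChar.map_add_eq_mul]
      ring_nf
    rw [sum_congr rfl h2, ← mul_sum, sum_erase_addChar_mul hψ]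
    simp

/-- The joint distribution of a quadratic form and a linear functional `polar Q γ`. -/
theorem card_quadraticForm_eq_and_polar_eq (hψ : ψ.IsPrimitive)
    (hS : ∀ z : k, z ≠ 0 → ∑ u, ψ (z * Q u) = S) {γ : V} (hγ : Q.polarBilin γ ≠ 0) (t s : k) :
    (Fintype.card k : ℂ) ^ 2 * #{u | Q u = t ∧ Q.polarBilin γ u = s}
      = Fintype.card V
        + S * Fintype.card k * ((#{v : k | Q γ * v ^ 2 + s * v + t = 0} : ℂ) - 1) := by
  set q : ℂ := (Fintype.card k : ℂ) with hq
  have h : ∀ u, q ^ 2 * (if Q u = t ∧ Q.polarBilin γ u = s then 1 else 0)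
      = ∑ z, ∑ w, ψ (z * (Q u - t)) * ψ (w * (Q.polarBilin γ u - s)) := by
    intro u
    simp_rw [← mul_sum, ← sum_mul, sum_addChar_mul hψ, sub_eq_zero]
    by_cases h1 : Q u = t <;> by_cases h2 : Q.polarBilin γ u = s <;> simp [h1, h2, sq, hq]
  rw [card_filter, Nat.cast_sum, mul_sum]
  push_cast
  simp_rw [h]
  rw [sum_comm, ← add_sum_erase _ _ (mem_univ 0)]
  congr 1
  · have h1 := sum_comp_linearMap hγ (fun x => ∑ w, ψ (w * (x - s)))
    have h2 : ∑ x, ∑ w, ψ (w * (x - s)) = q := by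
      simp_rw [sum_addChar_mul hψ, sub_eq_zero]
      simp [hq]
    rw [h2, mul_comm] at h1
    simpa using mul_right_cancel₀ (by simp) h1
  · have h1 : ∀ z ∈ univ.erase (0 : k),
        ∑ u, ∑ w, ψ (z * (Q u - t)) * ψ (w * (Q.polarBilin γ u - s))
          = ∑ v : k, S * ψ (z * -(Q γ * v ^ 2 + s * v + t)) := by
      intro z hz
      have hz0 := ne_of_mem_erase hz
      -- Substituting w = zv completes the square: Q(u) + vB(γ,u) = Q(u + vγ) - v²Q(γ). The sum over
      -- u is then S for every v.
      have h3 : ∀ u, ∑ w, ψ (z * (Q u - t)) * ψ (w * (Q.polarBilin γ u - s))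
          = ∑ v : k, ψ (z * Q (u + v • γ)) * ψ (z * -(Q γ * v ^ 2 + s * v + t)) := by
        intro u
        refine (Fintype.sum_equiv (Equiv.mulLeft₀ z hz0) _ _ fun v => ?_).symm
        simp_rw [← AddChar.map_add_eq_mul]
        rw [QuadraticMap.map_add_smul]
        congr 1
        change _ = z * (Q u - t) + z * v * (Q.polarBilin γ u - s)
        ring
      simp_rw [h3]
      rw [sum_comm]
      refine sum_congr rfl fun v _ => ?_
      rw [← hS z hz0, ← sum_mul]
      congr 1
      exact Fintype.sum_equiv (Equiv.addRight (v • γ)) _ _ fun _ => rfl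
    rw [sum_congr rfl h1, sum_comm]
    simp_rw [← mul_sum, sum_erase_addChar_mul hψ, neg_eq_zero]
    rw [mul_assoc]
    congr 1
    have h4 : ∀ v : k, (if Q γ * v ^ 2 + s * v + t = 0 then q - 1 else -1)
        = q * (if Q γ * v ^ 2 + s * v + t = 0 then 1 else 0) - 1 := by
      intro v
      split_ifs <;> ring
    simp_rw [← hq, h4, sum_sub_distrib, ← mul_sum, sum_boole]
    simp [← hq]
    ring

/-- If the nonzero values of `Q` are equidistributed, the exponential sums of `Q` are equal. -/
theorem sum_addChar_mul_quadraticForm (hψ : ψ.IsPrimitive) {N : ℕ}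
    (hN : ∀ t : k, t ≠ 0 → #{u | Q u = t} = N) {z : k} (hz : z ≠ 0) :
    ∑ u, ψ (z * Q u) = (#{u | Q u = 0} : ℂ) - N := by
  rw [← sum_fiberwise_of_maps_to (t := univ) (g := Q) fun _ _ => mem_univ _,
    ← add_sum_erase _ _ (mem_univ 0)]
  have h : ∀ t : k, ∑ u with Q u = t, ψ (z * Q u) = (#{u | Q u = t} : ℂ) * ψ (t * z) := by
    intro t
    rw [← nsmul_eq_mul]
    refine sum_eq_card_nsmul fun u hu => ?_
    rw [(mem_filter.mp hu).2, mul_comm]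
  rw [sum_congr rfl (g := fun t => (N : ℂ) * ψ (t * z)) (fun t ht => by
    rw [h, hN t (ne_of_mem_erase ht)]), ← mul_sum, sum_erase_addChar_mul hψ, if_neg hz, h]
  simp
  ring

end QuadraticFormCounts

/-! ### Cyclic groups and sets stable under multiplication -/

theorem exists_orderOf_eq_of_dvd_card {G : Type*} [Group G] [IsCyclic G] [Finite G] {d : ℕ}
    (hd : d ∣ Nat.card G) : ∃ g : G, orderOf g = d := by
  obtain ⟨g, hg⟩ := IsCyclic.exists_ofOrder_eq_natCard (α := G)
  obtain ⟨c, hc⟩ := hd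
  have hpos : 0 < Nat.card G := Nat.card_pos
  refine ⟨g ^ c, ?_⟩
  have hc0 : 0 < c := Nat.pos_of_ne_zero (by rintro rfl; simp [hc] at hpos)
  rw [orderOf_pow_of_dvd hc0.ne' (by rw [hg, hc]; exact dvd_mul_left _ _), hg, hc,
    Nat.mul_div_cancel _ hc0]

theorem exists_pow_eq_of_pow_eq_one {G : Type*} [CommGroup G] [IsCyclic G] [Finite G] {a b : ℕ}
    (hab : a * b ∣ Nat.card G) {u : G} (hu : u ^ b = 1) : ∃ c, c ^ a = u := by
  obtain ⟨g, hg⟩ := IsCyclic.exists_generator (α := G)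
  obtain ⟨j, rfl⟩ := Subgroup.mem_zpowers_iff.mp (hg u)
  have ho : orderOf g = Nat.card G := orderOf_eq_card_of_forall_mem_zpowers hg
  obtain ⟨c, hc⟩ := hab
  have hpos : 0 < Nat.card G := Nat.card_pos
  have hb : (b : ℤ) ≠ 0 := by rintro h; simp [Int.natCast_eq_zero.mp h] at hc; omega
  have h1 : (a * b : ℤ) ∣ j * b := by
    rw [← zpow_natCast, ← zpow_mul, ← orderOf_dvd_iff_zpow_eq_one, ho, hc] at hu
    exact (Dvd.intro (c : ℤ) (by push_cast; ring)).trans hu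
  obtain ⟨l, rfl⟩ := Int.dvd_of_mul_dvd_mul_right hb h1
  exact ⟨g ^ l, by rw [← zpow_natCast, ← zpow_mul, mul_comm]⟩

/-- Such a set is a union of cosets of the subgroup generated by `u`. This yields the congruences
mod q+1 that fix the sign of the exponential sum. -/
theorem orderOf_dvd_card_of_forall_mul_mem {F : Type*} [Field F] [Fintype F] {s : Finset F}
    (h0 : 0 ∉ s) (u : Fˣ) (hu : ∀ x ∈ s, u * x ∈ s) : orderOf u ∣ #s := by
  classical
  let t : Set Fˣ := {x | (x : F) ∈ s}
  have hpow : ∀ n : ℕ, ∀ x ∈ s, (u : F) ^ n * x ∈ s := by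
    intro n
    induction n with
    | zero => simp
    | succ n ih =>
      intro x hx
      rw [pow_succ', mul_assoc]
      exact hu _ (ih x hx)
  have ht : t = QuotientGroup.mk ⁻¹' (QuotientGroup.mk (s := Subgroup.zpowers u) '' t) := by
    refine Set.Subset.antisymm (Set.subset_preimage_image _ _) ?_
    rintro y ⟨x, hx, hxy⟩
    rw [QuotientGroup.eq, ← mem_powers_iff_mem_zpowers] at hxy
    obtain ⟨n, hn⟩ := hxy
    have : y = u ^ n * x := by
      rw [show u ^ n = x⁻¹ * y from hn, mul_comm, mul_inv_cancel_left]
    change (y : F) ∈ s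
    rw [this]
    push_cast
    exact hpow n _ hx
  have hcard : Nat.card t = #s := by
    rw [← Nat.card_eq_finsetCard s]
    refine Nat.card_congr ⟨fun x => ⟨x.1, x.2⟩,
      fun x => ⟨Units.mk0 x.1 fun h => h0 (h ▸ x.2), x.2⟩, fun x => ?_, fun x => ?_⟩
    · ext; rfl
    · ext; rfl
  rw [← hcard, ht, Nat.card_congr (QuotientGroup.preimageMkEquivSubgroupProdSet _ _),
    Nat.card_prod, Nat.card_zpowers]
  exact dvd_mul_right _ _

/-! ### The form Tr(x^(q+1)): radical, scaling and exponential sum -/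

section HermitianTraceForm

variable (k F : Type*) [Field k] [Fintype k] [Field F] [Fintype F] [Algebra k F]

/-- The quadratic form `x ↦ Tr (x ^ (q + 1))` on an extension of the field with `q` elements. -/
noncomputable def hermitianTraceForm : QuadraticForm k F :=
  LinearMap.BilinMap.toQuadraticMap
    ((Algebra.traceForm k F).compl₁₂ (FiniteField.frobeniusAlgHom k F).toLinearMap LinearMap.id)

variable {k F}


omit [Fintype F] in
theorem hermitianTraceForm_apply (x : F) :
    hermitianTraceForm k F x = Algebra.trace k F (x ^ (Fintype.card k + 1)) := by
  simp [hermitianTraceForm, Algebra.traceForm_apply, pow_succ]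

omit [Fintype F] in
theorem polarBilin_hermitianTraceForm (x y : F) :
    (hermitianTraceForm k F).polarBilin x y
      = Algebra.trace k F (x ^ Fintype.card k * y)
        + Algebra.trace k F (y ^ Fintype.card k * x) := by
  simp [hermitianTraceForm, Algebra.traceForm_apply, LinearMap.BilinMap.polar_toQuadraticMap]

theorem trace_pow_card (x : F) : Algebra.trace k F (x ^ Fintype.card k) = Algebra.trace k F x :=
  Algebra.trace_eq_of_algEquiv (FiniteField.frobeniusAlgEquivOfAlgebraic k F) x

/-- The trace is invariant under Frobenius; applying it to x^q y collects both terms of the polar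
form into one multiple of y^q, and the trace form is nondegenerate. -/
theorem polarBilin_hermitianTraceForm_eq_zero_iff (x : F) :
    (hermitianTraceForm k F).polarBilin x = 0 ↔ x ^ (Fintype.card k ^ 2) + x = 0 := by
  have h : ∀ y, (hermitianTraceForm k F).polarBilin x y
      = Algebra.trace k F ((x ^ (Fintype.card k ^ 2) + x) * y ^ Fintype.card k) := by
    intro y
    rw [polarBilin_hermitianTraceForm, ← trace_pow_card (x ^ Fintype.card k * y), ← map_add]
    congr 1
    ring
  constructor
  · intro hx
    refine (traceForm_nondegenerate k F).1 _ fun z => ?_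
    obtain ⟨y, rfl⟩ := (FiniteField.frobeniusAlgEquivOfAlgebraic k F).surjective z
    rw [Algebra.traceForm_apply]
    exact (h y).symm.trans (by rw [hx]; rfl)
  · intro hx
    ext y
    rw [h, hx]
    simp

omit [Fintype F] in
theorem hermitianTraceForm_mul {c : F} {t : k} (hc : c ^ (Fintype.card k + 1) = algebraMap k F t)
    (x : F) :
    hermitianTraceForm k F (c * x) = t * hermitianTraceForm k F x := by
  rw [hermitianTraceForm_apply, hermitianTraceForm_apply, mul_pow, hc, ← Algebra.smul_def,
    map_smul, smul_eq_mul]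

variable {m : ℕ} (hm : Even m) (hF : Fintype.card F = Fintype.card k ^ (2 * m))

omit [Algebra k F] in
include hm hF in
-- Since m is even, q⁴ - 1 = (q² + 1)(q² - 1) divides q^(2m) - 1, and q² + 1 is even.
theorem dvd_card_units (hk : ringChar k ≠ 2) : 2 * (Fintype.card k ^ 2 - 1) ∣ Nat.card Fˣ := by
  obtain ⟨l, rfl⟩ := hm
  rw [Nat.card_units, Nat.card_eq_fintype_card, hF]
  have h1 : Fintype.card k ^ (2 * (l + l)) - 1 = ((Fintype.card k ^ 2) ^ 2) ^ l - 1 ^ l := by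
    rw [one_pow]; ring_nf
  have h2 : (Fintype.card k ^ 2) ^ 2 - 1 = (Fintype.card k ^ 2 + 1) * (Fintype.card k ^ 2 - 1) := by
    simpa using Nat.sq_sub_sq (Fintype.card k ^ 2) 1
  rw [h1]
  refine (mul_dvd_mul_right ?_ _).trans (h2 ▸ Nat.sub_dvd_pow_sub_pow _ _ l)
  have h3 : Odd (Fintype.card k) := by
    rw [Nat.odd_iff]
    exact FiniteField.odd_card_of_char_ne_two hk
  exact (h3.pow.add_odd odd_one).two_dvd

include hm hF in
-- An element r of order 2(q² - 1) satisfies r^(q²-1) = -1, so the nonzero radical is the coset of r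
-- modulo the (q²-1)-th roots of unity, all of which lie in F.
theorem card_ker_polarBilin_hermitianTraceForm (hk : ringChar k ≠ 2) :
    Nat.card (LinearMap.ker (hermitianTraceForm k F).polarBilin) = Fintype.card k ^ 2 := by
  classical
  have hq : 1 < Fintype.card k := Fintype.one_lt_card
  have hq2 : 1 < Fintype.card k ^ 2 := Nat.one_lt_pow two_ne_zero hq
  obtain ⟨r, hr⟩ := exists_orderOf_eq_of_dvd_card (dvd_card_units (F := F) hm hF hk)
  have hr1 : (r : F) ^ (Fintype.card k ^ 2 - 1) = -1 := by
    have h1 : ((r : F) ^ (Fintype.card k ^ 2 - 1)) ^ 2 = 1 := by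
      rw [← pow_mul, mul_comm, ← hr]
      rw [← Units.val_pow_eq_pow_val, pow_orderOf_eq_one, Units.val_one]
    refine (sq_eq_one_iff.mp h1).resolve_left fun h2 => ?_
    have h3 : r ^ (Fintype.card k ^ 2 - 1) = 1 := Units.ext (by simpa using h2)
    have h4 := Nat.le_of_dvd (by omega) (orderOf_dvd_of_pow_eq_one h3)
    omega
  have h2 : IsPrimitiveRoot ((r : F) ^ 2) (Fintype.card k ^ 2 - 1) := by
    have h3 : IsPrimitiveRoot r (2 * (Fintype.card k ^ 2 - 1)) := hr ▸ IsPrimitiveRoot.orderOf r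
    exact (IsPrimitiveRoot.coe_units_iff.mpr h3).pow (by omega) rfl
  have h3 : #{x : F | x ^ (Fintype.card k ^ 2) + x = 0}
      = #(insert 0 ((Polynomial.nthRootsFinset (Fintype.card k ^ 2 - 1) (1 : F)).image
          fun x => (r : F) * x)) := by
    congr 1
    ext x
    have hx : x ^ (Fintype.card k ^ 2) = x ^ (Fintype.card k ^ 2 - 1) * x := by
      rw [← pow_succ]; congr 1; omega
    simp only [mem_filter, mem_univ, true_and, mem_insert, mem_image,
      Polynomial.mem_nthRootsFinset (show 0 < Fintype.card k ^ 2 - 1 by omega)]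
    constructor
    · intro h
      by_cases hx0 : x = 0
      · exact Or.inl hx0
      · right
        refine ⟨(r : F)⁻¹ * x, ?_, by simp⟩
        have h4 : (x ^ (Fintype.card k ^ 2 - 1) + 1) * x = 0 := by rw [← h, hx]; ring
        rw [mul_pow, inv_pow, hr1, eq_neg_of_add_eq_zero_left
          ((mul_eq_zero.mp h4).resolve_right hx0)]
        norm_num
    · rintro (rfl | ⟨y, hy, rfl⟩)
      · rw [zero_pow (by omega), add_zero]
      · rw [hx, mul_pow, hr1, hy]
        ring
  rw [Nat.card_eq_fintype_card, Fintype.card_subtype]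
  simp only [LinearMap.mem_ker, polarBilin_hermitianTraceForm_eq_zero_iff]
  rw [h3, card_insert_of_notMem, card_image_of_injective _ (mul_right_injective₀ r.ne_zero),
    h2.card_nthRootsFinset]
  · omega
  · simp only [mem_image, not_exists, not_and]
    intro x hx h
    have hx0 : x = 0 := (mul_eq_zero.mp h).resolve_left r.ne_zero
    rw [hx0, Polynomial.mem_nthRootsFinset (show 0 < Fintype.card k ^ 2 - 1 by omega),
      zero_pow (by omega)] at hx
    exact zero_ne_one hx

include hm hF in
-- As t^(q-1) = 1 and (q+1)(q-1) divides |Fˣ|, t is some c^(q+1); multiplication by c maps the level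
-- set of 1 onto that of t.
theorem card_hermitianTraceForm_eq [DecidableEq k] (hk : ringChar k ≠ 2) {t : k} (ht : t ≠ 0) :
    #{x | hermitianTraceForm k F x = t} = #{x | hermitianTraceForm k F x = 1} := by
  have h1 : (Fintype.card k + 1) * (Fintype.card k - 1) ∣ Nat.card Fˣ := by
    have := Nat.sq_sub_sq (Fintype.card k) 1
    rw [one_pow] at this
    exact this ▸ (dvd_mul_left _ _).trans (dvd_card_units hm hF hk)
  obtain ⟨c, hc⟩ := exists_pow_eq_of_pow_eq_one h1
    (u := Units.map (algebraMap k F).toMonoidHom (Units.mk0 t ht)) (by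
      rw [← map_pow, show Units.mk0 t ht ^ (Fintype.card k - 1) = 1 from
        Units.ext (by simpa using FiniteField.pow_card_sub_one_eq_one t ht), map_one])
  have hc' : (c : F) ^ (Fintype.card k + 1) = algebraMap k F t := by
    have := congrArg Units.val hc
    simpa using this
  refine (card_bij (fun x _ => (c : F) * x) ?_ ?_ ?_).symm
  · intro x hx
    simp only [mem_filter, mem_univ, true_and] at hx ⊢
    rw [hermitianTraceForm_mul hc', hx, mul_one]
  · intro x _ y _ h
    exact mul_left_cancel₀ c.ne_zero h
  · intro y hy
    simp only [mem_filter, mem_univ, true_and] at hy ⊢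
    refine ⟨(c : F)⁻¹ * y, ?_, by simp⟩
    have h2 := hermitianTraceForm_mul hc' ((c : F)⁻¹ * y)
    rw [mul_inv_cancel_left₀ c.ne_zero, hy] at h2
    exact (mul_left_cancel₀ ht (by rw [← h2, mul_one]))

include hm hF in
theorem sum_addChar_hermitianTraceForm (hk : ringChar k ≠ 2) {ψ : AddChar k ℂ}
    (hψ : ψ.IsPrimitive) {z : k} (hz : z ≠ 0) :
    ∑ x, ψ (z * hermitianTraceForm k F x) = -(Fintype.card k : ℂ) ^ (m + 1) := by
  classical
  set N₀ := #{x : F | hermitianTraceForm k F x = 0} with hN₀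
  set N₁ := #{x : F | hermitianTraceForm k F x = 1} with hN₁
  have hS : ∀ z : k, z ≠ 0 → ∑ x, ψ (z * hermitianTraceForm k F x) = (N₀ : ℂ) - N₁ := fun z hz =>
    sum_addChar_mul_quadraticForm _ hψ (fun t ht => card_hermitianTraceForm_eq hm hF hk ht) hz
  have hsq := sq_sum_addChar_quadraticForm _ hk hψ hS
  rw [card_ker_polarBilin_hermitianTraceForm hm hF hk, hF] at hsq
  have hsq' : ((N₀ : ℤ) - N₁) ^ 2 = ((Fintype.card k : ℤ) ^ (m + 1)) ^ 2 := by
    have : (((N₀ : ℤ) - N₁ : ℤ) : ℂ) ^ 2 = (((Fintype.card k : ℤ) ^ (m + 1) : ℤ) : ℂ) ^ 2 := by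
      push_cast
      rw [hsq]
      push_cast
      ring
    exact_mod_cast this
  have h1 : (Fintype.card k + 1) ∣ 2 * (Fintype.card k ^ 2 - 1) := by
    have := Nat.sq_sub_sq (Fintype.card k) 1
    rw [one_pow] at this
    rw [this]
    exact (dvd_mul_right _ _).mul_left _
  obtain ⟨u, hu⟩ := exists_orderOf_eq_of_dvd_card (h1.trans (dvd_card_units (F := F) hm hF hk))
  have hu1 : (u : F) ^ (Fintype.card k + 1) = algebraMap k F 1 := by
    rw [map_one, ← hu]
    rw [← Units.val_pow_eq_pow_val, pow_orderOf_eq_one, Units.val_one]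
  have hd1 : Fintype.card k + 1 ∣ N₁ := by
    rw [← hu]
    refine orderOf_dvd_card_of_forall_mul_mem (by simp) u fun x hx => ?_
    simp only [mem_filter, mem_univ, true_and] at hx ⊢
    rw [hermitianTraceForm_mul hu1, hx, mul_one]
  have hd0 : Fintype.card k + 1 ∣ N₀ - 1 := by
    rw [← card_erase_of_mem (s := {x : F | hermitianTraceForm k F x = 0}) (a := 0)
      (by simp), ← hu]
    refine orderOf_dvd_card_of_forall_mul_mem (by simp) u fun x hx => ?_
    simp only [mem_erase, mem_filter, mem_univ, true_and] at hx ⊢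
    rw [hermitianTraceForm_mul hu1, hx.2, mul_zero]
    exact ⟨mul_ne_zero u.ne_zero hx.1, rfl⟩
  have hpos : 1 ≤ N₀ := card_pos.mpr ⟨0, by simp⟩
  have hd : ((Fintype.card k : ℤ) + 1) ∣ (N₀ : ℤ) - N₁ - 1 := by
    have e0 : ((Fintype.card k : ℤ) + 1) ∣ (N₀ : ℤ) - 1 := by
      have := Int.natCast_dvd_natCast.mpr hd0
      rwa [Nat.cast_sub hpos, Nat.cast_add, Nat.cast_one] at this
    have e1 : ((Fintype.card k : ℤ) + 1) ∣ (N₁ : ℤ) := by exact_mod_cast hd1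
    have := dvd_sub e0 e1
    rwa [sub_right_comm] at this
  -- Since m + 1 is odd, q^(m+1) ≡ -1 mod q+1. The positive root would give q + 1 ∣ 2.
  have hval : (N₀ : ℤ) - N₁ = -(Fintype.card k : ℤ) ^ (m + 1) := by
    refine (sq_eq_sq_iff_eq_or_eq_neg.mp hsq').resolve_left fun h => ?_
    rw [h] at hd
    have h3 : ((Fintype.card k : ℤ) + 1) ∣ (Fintype.card k : ℤ) ^ (m + 1) + 1 := by
      have := (hm.add_odd odd_one).add_dvd_pow_add_pow (Fintype.card k : ℤ) 1
      simpa using this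
    have h4 := dvd_sub h3 hd
    have h5 : (Fintype.card k : ℤ) ^ (m + 1) + 1 - ((Fintype.card k : ℤ) ^ (m + 1) - 1) = 2 := by
      ring
    rw [h5] at h4
    have h6 := Int.le_of_dvd (by norm_num) h4
    have h7 : 1 < Fintype.card k := Fintype.one_lt_card
    omega
  rw [hS z hz]
  exact_mod_cast hval

end HermitianTraceForm

/-! ### Counting arguments at which a quadratic has a prescribed character -/

section QuadraticCharCounts

variable {k : Type*} [Field k] [Fintype k] [DecidableEq k]

theorem card_quadraticChar_eq (hk : ringChar k ≠ 2) {d : k} (hd : d ≠ 0) :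
    (#{t : k | quadraticChar k t = quadraticChar k d} : ℚ) = (Fintype.card k - 1) / 2 := by
  have h := sum_apply_quadraticChar_mul hk (one_ne_zero (α := k))
    (fun y => if y = quadraticChar k d then (1 : ℚ) else 0)
  rw [sum_erase_eq_sub (mem_univ _)] at h
  simp only [one_mul, sum_boole] at h
  rcases quadraticChar_dichotomy hd with h' | h' <;> norm_num [h'] at h ⊢ <;> linarith

/-- The number of arguments where `b * v ^ 2 + c * v + d` has the quadratic character of `-d`. -/
def quadraticCharCount (d b c : k) : ℕ :=
  #{v : k | quadraticChar k (b * v ^ 2 + c * v + d) = quadraticChar k (-d)}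

theorem quadraticChar_neg' (d : k) :
    quadraticChar k (-d) = quadraticChar k (-1) * quadraticChar k d := by
  rw [← map_mul, neg_one_mul]

theorem quadraticChar_eq_neg_iff {d : k} (hd : d ≠ 0) :
    quadraticChar k d = quadraticChar k (-d) ↔ quadraticChar k (-1) = 1 := by
  rw [quadraticChar_neg']
  rcases quadraticChar_dichotomy hd with h | h <;> rw [h] <;>
  rcases quadraticChar_dichotomy (neg_ne_zero.mpr (one_ne_zero (α := k))) with h' | h' <;>
  rw [h'] <;> norm_num

theorem quadraticCharCount_zero_zero {d : k} (hd : d ≠ 0) :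
    (quadraticCharCount d 0 0 : ℚ)
      = (1 + quadraticChar k (-1)) / 2 * Fintype.card k := by
  have h := quadraticChar_eq_neg_iff hd
  rcases quadraticChar_dichotomy (neg_ne_zero.mpr (one_ne_zero (α := k))) with h' | h' <;>
  simp [quadraticCharCount, h, h', -quadraticChar_apply]

theorem quadraticCharCount_zero_left (hk : ringChar k ≠ 2) {d c : k} (hd : d ≠ 0) (hc : c ≠ 0) :
    (quadraticCharCount d 0 c : ℚ) = (Fintype.card k - 1) / 2 := by
  rw [← card_quadraticChar_eq hk (neg_ne_zero.mpr hd), quadraticCharCount, card_filter,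
    card_filter, ← sum_comp_affine hc d
      (fun v => if quadraticChar k v = quadraticChar k (-d) then 1 else 0)]
  simp_rw [zero_mul, zero_add]

/-- From c² = 4bd, b and d have the same character, so the polynomial has the character of d off its
double root; this is the character of -d exactly when -1 is a square. -/
theorem quadraticCharCount_of_discrim_eq_zero (hk : ringChar k ≠ 2) {d b c : k} (hd : d ≠ 0)
    (hb : b ≠ 0) (h : c ^ 2 - 4 * b * d = 0) :
    (quadraticCharCount d b c : ℚ)
      = (1 + quadraticChar k (-1)) / 2 * (Fintype.card k - 1) := by
  have h2 : (2 : k) ≠ 0 := Ring.two_ne_zero hk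
  have hbd : quadraticChar k b = quadraticChar k d := by
    have hc : c ≠ 0 := by
      rintro rfl
      have h4 : (4 : k) ≠ 0 := by
        rw [show (4 : k) = 2 * 2 by norm_num]
        exact mul_ne_zero h2 h2
      simp [h4, hb, hd] at h
    have h1 : quadraticChar k (c ^ 2) = quadraticChar k (2 ^ 2 * (b * d)) := by
      congr 1
      linear_combination h
    rw [map_mul, quadraticChar_sq_one' hc, quadraticChar_sq_one' h2, one_mul, map_mul] at h1
    rcases quadraticChar_dichotomy hb with h3 | h3 <;>
    rcases quadraticChar_dichotomy hd with h4 | h4 <;> rw [h3, h4] at h1 ⊢ <;> norm_num at h1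
  have h5 : quadraticCharCount d b c
      = #{v : k | quadraticChar k d * quadraticChar k (v ^ 2) = quadraticChar k (-d)} := by
    rw [quadraticCharCount, card_filter, card_filter, ← sum_comp_affine (mul_ne_zero h2 hb) c
      (fun v => if quadraticChar k d * quadraticChar k (v ^ 2) = quadraticChar k (-d)
        then 1 else 0)]
    refine sum_congr rfl fun v _ => ?_
    rw [quadraticChar_quadratic hk hb, h, sub_zero, hbd]
  have h6 : ∀ v : k, quadraticChar k d * quadraticChar k (v ^ 2) = quadraticChar k (-d)
      ↔ v ≠ 0 ∧ quadraticChar k (-1) = 1 := by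
    intro v
    by_cases hv : v = 0
    · have h6 : quadraticChar k (-d) ≠ 0 := by
        rwa [Ne, quadraticChar_eq_zero_iff, neg_eq_zero]
      simp [hv, h6.symm, -quadraticChar_apply, MulChar.map_zero]
    · rw [quadraticChar_sq_one' hv, mul_one, quadraticChar_eq_neg_iff hd]
      simp [hv]
  rw [h5]
  simp_rw [h6]
  have h7 : (#{v : k | v ≠ 0} : ℚ) = Fintype.card k - 1 := by
    rw [filter_ne', card_erase_of_mem (mem_univ _), card_univ, Nat.cast_sub Fintype.card_pos,
      Nat.cast_one]
  rcases quadraticChar_dichotomy (neg_ne_zero.mpr (one_ne_zero (α := k))) with h' | h'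
  · simp only [h', and_true, h7]
    norm_num
  · simp [h']

theorem quadraticCharCount_of_discrim_ne_zero (hk : ringChar k ≠ 2) {d b c : k} (hd : d ≠ 0)
    (hb : b ≠ 0) (h : c ^ 2 - 4 * b * d ≠ 0) :
    (quadraticCharCount d b c : ℚ)
      = (Fintype.card k - 1 - quadraticChar k (c ^ 2 - 4 * b * d)
        - quadraticChar k (-1) * quadraticChar k (d * b)) / 2 := by
  rw [quadraticCharCount, card_quadraticChar_quadratic_eq hk hb c d h (neg_ne_zero.mpr hd),
    quadraticChar_neg', map_mul]
  push_cast
  ring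

/-- The weighted sum of a function of `quadraticCharCount` over all pairs of coefficients. -/
theorem sum_quadraticCharCount (hk : ringChar k ≠ 2) {d : k} (hd : d ≠ 0) (X Y : ℚ)
    (G : ℚ → ℚ) :
    ∑ b : k, ∑ c : k, (X - Y * quadraticChar k (c ^ 2 - 4 * b * d)) * G (quadraticCharCount d b c)
      = X * G ((1 + quadraticChar k (-1)) / 2 * Fintype.card k)
        + (Fintype.card k - 1) * (X - Y) * G ((Fintype.card k - 1) / 2)
        + (Fintype.card k - 1) / 2 * (
          2 * X * G ((1 + quadraticChar k (-1)) / 2 * (Fintype.card k - 1))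
          + (Fintype.card k - 3) / 2 * (X - Y) * G ((Fintype.card k - 2 - quadraticChar k (-1)) / 2)
          + (Fintype.card k - 1) / 2 * (X - Y) * G ((Fintype.card k - 2 + quadraticChar k (-1)) / 2)
          + (Fintype.card k - 1) / 2 * (X + Y) * G ((Fintype.card k - quadraticChar k (-1)) / 2)
          + (Fintype.card k + 1) / 2 * (X + Y)
            * G ((Fintype.card k + quadraticChar k (-1)) / 2)) := by
  have h2 : (2 : k) ≠ 0 := Ring.two_ne_zero hk
  rw [← add_sum_erase _ _ (mem_univ 0)]
  congr 1
  · rw [← add_sum_erase _ _ (mem_univ 0), quadraticCharCount_zero_zero hd]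
    congr 1
    · simp
    · rw [sum_congr rfl (g := fun _ => (X - Y) * G ((Fintype.card k - 1) / 2))]
      · rw [sum_const, card_erase_of_mem (mem_univ _), card_univ, nsmul_eq_mul,
          Nat.cast_sub Fintype.card_pos, Nat.cast_one]
        ring
      · intro c hc
        have hc0 := ne_of_mem_erase hc
        rw [quadraticCharCount_zero_left hk hd hc0, mul_zero, zero_mul, sub_zero,
          quadraticChar_sq_one' hc0]
        simp
  -- The inner sum over c for fixed b ≠ 0, with y the character of db. The three terms belong to
  -- discriminant zero, nonzero square and non-square, with 1 + y, (q-2-y)/2 and (q-y)/2 values of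
  -- c.
  · let H : ℤ → ℚ := fun y =>
      (1 + y) * X * G ((1 + quadraticChar k (-1)) / 2 * (Fintype.card k - 1))
      + (Fintype.card k - 2 - y) / 2 * (X - Y)
          * G ((Fintype.card k - 2 - quadraticChar k (-1) * y) / 2)
      + (Fintype.card k - y) / 2 * (X + Y) * G ((Fintype.card k - quadraticChar k (-1) * y) / 2)
    rw [sum_congr rfl (g := fun b => H (quadraticChar k (d * b)))]
    · rw [sum_apply_quadraticChar_mul hk hd]
      simp only [H]
      push_cast
      ring_nf
    · intro b hb
      have hb0 := ne_of_mem_erase hb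
      let K : ℤ → ℚ := fun y => (X - Y * y) *
        if y = 0 then G ((1 + quadraticChar k (-1)) / 2 * (Fintype.card k - 1))
        else G ((Fintype.card k - 1 - y - quadraticChar k (-1) * quadraticChar k (d * b)) / 2)
      have h4 : 4 * b * d ≠ 0 := by
        rw [show 4 * b * d = 2 * 2 * b * d by ring]
        exact mul_ne_zero (mul_ne_zero (mul_ne_zero h2 h2) hb0) hd
      have hη : quadraticChar k (4 * b * d) = quadraticChar k (d * b) := by
        rw [show 4 * b * d = 2 ^ 2 * (d * b) by ring, map_mul, quadraticChar_sq_one' h2, one_mul]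
      rw [sum_congr rfl (g := fun c => K (quadraticChar k (c ^ 2 - 4 * b * d)))]
      · rw [sum_apply_quadraticChar_sq_sub hk h4, hη]
        simp only [K, H, if_true, one_ne_zero, neg_eq_zero, if_false]
        push_cast
        ring_nf
      · intro c _
        simp only [K]
        by_cases h : c ^ 2 - 4 * b * d = 0
        · rw [quadraticCharCount_of_discrim_eq_zero hk hd hb0 h, h]
          simp
        · rw [quadraticCharCount_of_discrim_ne_zero hk hd hb0 h,
            if_neg (by rwa [quadraticChar_eq_zero_iff])]

end QuadraticCharCounts

/-! ### The weights of all functionals on the defining set of a quadratic form -/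

section QuadraticFormCodes

variable {k : Type*} [Field k] [Fintype k] [DecidableEq k] {V : Type*} [AddCommGroup V]
  [Module k V] [Fintype V]

omit [Fintype k] [DecidableEq k] in
/-- The sum of a function over the fibres of a linear map. -/
theorem sum_comp_linearMap_fiber {W : Type*} [AddCommGroup W] [Module k W] [DecidableEq W]
    (f : V →ₗ[k] W) (g : W → ℚ) :
    ∑ v, g (f v) = Nat.card (LinearMap.ker f) * ∑ w ∈ univ.image f, g w := by
  classical
  rw [← sum_fiberwise_of_maps_to (t := univ.image f) (g := f)
    fun v _ => mem_image_of_mem f (mem_univ v), mul_sum]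
  refine sum_congr rfl fun w hw => ?_
  obtain ⟨v₀, -, rfl⟩ := mem_image.mp hw
  have h : #{v | f v = f v₀} = Nat.card (LinearMap.ker f) := by
    rw [Nat.card_eq_fintype_card, Fintype.card_subtype]
    refine card_bij (fun v _ => v - v₀) ?_ ?_ ?_
    · intro v hv
      simp only [mem_filter, mem_univ, true_and] at hv
      simp [hv]
    · intro v _ v' _ h
      exact sub_left_injective h
    · intro v hv
      simp only [LinearMap.mem_ker, mem_filter, mem_univ, true_and] at hv
      exact ⟨v + v₀, by simp [hv], by simp⟩
  rw [← h, ← nsmul_eq_mul]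
  refine sum_eq_card_nsmul fun v hv => ?_
  rw [(mem_filter.mp hv).2]

/-- Functionals that vanish on the radical of a quadratic form come from its polar form. -/
theorem QuadraticMap.exists_polarBilin_eq {k V : Type*} [Field k] [AddCommGroup V] [Module k V]
    [FiniteDimensional k V] (Q : QuadraticForm k V) {f : Module.Dual k V}
    (hf : ∀ r, Q.polarBilin r = 0 → f r = 0) : ∃ γ, Q.polarBilin γ = f := by
  have h1 : f ∈ (LinearMap.ker Q.polarBilin).dualAnnihilator := by
    rw [Submodule.mem_dualAnnihilator]
    exact fun r hr => hf r hr
  rw [← LinearMap.range_dualMap_eq_dualAnnihilator_ker] at h1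
  obtain ⟨φ, rfl⟩ := h1
  obtain ⟨γ, rfl⟩ := (Module.evalEquiv k V).surjective φ
  refine ⟨γ, LinearMap.ext fun u => ?_⟩
  simp [QuadraticMap.polar_comm]

omit [Fintype V] in
/-- A set invariant under translation by `r` is equidistributed with respect to functionals that do
not vanish at `r`. -/
theorem card_filter_linearMap_eq_zero {D : Finset V} {f : V →ₗ[k] k} {r : V} (hr : f r ≠ 0)
    (hD : ∀ (v : k) (x : V), x + v • r ∈ D ↔ x ∈ D) :
    Fintype.card k * #{x ∈ D | f x = 0} = #D := by
  have h : ∀ s ∈ (univ : Finset k), #{x ∈ D | f x = s} = #{x ∈ D | f x = 0} := by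
    intro s _
    refine card_bij' (fun x _ => x + (-s / f r) • r) (fun x _ => x + (s / f r) • r) ?_ ?_ ?_ ?_
    · intro x hx
      simp only [mem_filter] at hx ⊢
      refine ⟨(hD _ _).mpr hx.1, ?_⟩
      rw [map_add, map_smul, hx.2, smul_eq_mul]
      field_simp
      ring
    · intro x hx
      simp only [mem_filter] at hx ⊢
      refine ⟨(hD _ _).mpr hx.1, ?_⟩
      rw [map_add, map_smul, hx.2, smul_eq_mul]
      field_simp
      ring
    · intro x _
      simp [neg_div]
    · intro x _
      simp [neg_div]
  conv_rhs => rw [card_eq_sum_card_fiberwise (s := D) (f := f) (t := univ) fun _ _ => mem_univ _]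
  rw [sum_congr rfl h]
  simp

variable {Q : QuadraticForm k V} {ψ : AddChar k ℂ} {m : ℕ} {h : V} {D : Finset V}

section
variable (hψ : ψ.IsPrimitive)
  (hS : ∀ z : k, z ≠ 0 → ∑ u, ψ (z * Q u) = -(Fintype.card k : ℂ) ^ (m + 1))
  (hV : Fintype.card V = Fintype.card k ^ (2 * m)) (hm : m ≠ 0)

include hψ hS hV

/-- The radical is recovered from S² = |V| · |radical|. -/
theorem card_ker_polarBilin (hk : ringChar k ≠ 2) :
    Nat.card (LinearMap.ker Q.polarBilin) = Fintype.card k ^ 2 := by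
  have h1 := sq_sum_addChar_quadraticForm Q hk hψ hS
  have hq : (Fintype.card k : ℂ) ≠ 0 := by simp
  rw [hV] at h1
  have h2 : (Nat.card (LinearMap.ker Q.polarBilin) : ℂ) = (Fintype.card k : ℂ) ^ 2 := by
    refine mul_left_cancel₀ (pow_ne_zero (2 * m) hq) ?_
    push_cast at h1
    rw [← h1]
    ring
  exact_mod_cast h2

include hm

theorem card_level_eq (t : k) :
    (#{u | Q u = t} : ℚ) = (Fintype.card k : ℚ) ^ (2 * m - 1) + (Fintype.card k : ℚ) ^ m
      - (Fintype.card k : ℚ) ^ (m + 1) * if t = 0 then 1 else 0 := by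
  have h1 := card_quadraticForm_eq Q hψ hS t
  have hq : (Fintype.card k : ℚ) ≠ 0 := by simp
  rw [hV] at h1
  refine mul_left_cancel₀ hq ?_
  have h2 : (Fintype.card k : ℚ) * #{u | Q u = t} = (Fintype.card k : ℚ) ^ (2 * m)
      - (Fintype.card k : ℚ) ^ (m + 1) * (if t = 0 then (Fintype.card k : ℚ) - 1 else -1) := by
    have : (((Fintype.card k : ℚ) * #{u | Q u = t} : ℚ) : ℂ) = ((Fintype.card k : ℚ) ^ (2 * m)
      - (Fintype.card k : ℚ) ^ (m + 1) *
        (if t = 0 then (Fintype.card k : ℚ) - 1 else -1) : ℚ) := by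
      push_cast
      rw [h1]
      split_ifs <;> (push_cast; ring)
    exact_mod_cast this
  rw [h2]
  obtain ⟨n, rfl⟩ := Nat.exists_eq_succ_of_ne_zero hm
  rw [show 2 * n.succ - 1 = 2 * n + 1 by omega]
  split_ifs <;> (rw [Nat.succ_eq_add_one]; ring)

theorem card_level_and_polar_eq {γ : V} (hγ : Q.polarBilin γ ≠ 0) (t s : k) :
    (#{u | Q u = t ∧ Q.polarBilin γ u = s} : ℚ)
      = (Fintype.card k : ℚ) ^ (2 * m - 2) + (Fintype.card k : ℚ) ^ m
        - (Fintype.card k : ℚ) ^ m * #{v : k | Q γ * v ^ 2 + s * v + t = 0} := by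
  have h1 := card_quadraticForm_eq_and_polar_eq Q hψ hS hγ t s
  have hq : (Fintype.card k : ℚ) ≠ 0 := by simp
  rw [hV] at h1
  refine mul_left_cancel₀ (pow_ne_zero 2 hq) ?_
  have h2 : (Fintype.card k : ℚ) ^ 2 * #{u | Q u = t ∧ Q.polarBilin γ u = s}
      = (Fintype.card k : ℚ) ^ (2 * m) - (Fintype.card k : ℚ) ^ (m + 1) * Fintype.card k
        * (#{v : k | Q γ * v ^ 2 + s * v + t = 0} - 1) := by
    have : (((Fintype.card k : ℚ) ^ 2 * #{u | Q u = t ∧ Q.polarBilin γ u = s} : ℚ) : ℂ)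
      = ((Fintype.card k : ℚ) ^ (2 * m) - (Fintype.card k : ℚ) ^ (m + 1) * Fintype.card k
        * (#{v : k | Q γ * v ^ 2 + s * v + t = 0} - 1) : ℚ) := by
      push_cast
      rw [h1]
      push_cast
      ring
    exact_mod_cast this
  rw [h2]
  obtain ⟨n, rfl⟩ := Nat.exists_eq_succ_of_ne_zero hm
  rw [show 2 * n.succ - 2 = 2 * n by omega, Nat.succ_eq_add_one]
  ring

end

/-- Translating by `h` turns `Q u - Q h` into `Q x - polar Q h x`. -/
theorem quadraticForm_add_sub_polar {k V : Type*} [Field k] [AddCommGroup V] [Module k V]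
    (Q : QuadraticForm k V) (h u : V) :
    Q (u + h) - Q.polarBilin h (u + h) = Q u - Q h := by
  have h1 := QuadraticMap.map_add_smul Q u h 1
  have h2 : Q.polarBilin h h = 2 * Q h := by simp
  rw [one_smul] at h1
  rw [h1, map_add, h2]
  ring

theorem card_filter_add (p : V → Prop) [DecidablePred p] :
    #{x | p x} = #{u | p (u + h)} := by
  rw [card_filter, card_filter]
  exact (Fintype.sum_equiv (Equiv.addRight h) _ _ fun _ => rfl).symm

section
variable (hψ : ψ.IsPrimitive)
  (hS : ∀ z : k, z ≠ 0 → ∑ u, ψ (z * Q u) = -(Fintype.card k : ℂ) ^ (m + 1))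
  (hV : Fintype.card V = Fintype.card k ^ (2 * m)) (hm : m ≠ 0)
  (hk : ringChar k ≠ 2) (hQh : Q h ≠ 0)
  (hD : ∀ x, x ∈ D ↔ quadraticChar k (Q x - Q.polarBilin h x) = quadraticChar k (Q h))

include hD in
-- Translation by h removes the linear term from the condition defining D, which then only involves
-- the value t of Q.
theorem card_filter_definingSet (f : V →ₗ[k] k) :
    #{x ∈ D | f x = 0}
      = ∑ t with quadraticChar k (t - Q h) = quadraticChar k (Q h),
        #{u | Q u = t ∧ f u = -f h} := by
  have h1 : #{x ∈ D | f x = 0} = #{u | quadraticChar k (Q u - Q h) = quadraticChar k (Q h) ∧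
      f u = -f h} := by
    have : ({x ∈ D | f x = 0} : Finset V) = ({x | quadraticChar k (Q x - Q.polarBilin h x) =
        quadraticChar k (Q h) ∧ f x = 0} : Finset V) := by
      ext x
      simp [hD, -quadraticChar_apply]
    rw [this, card_filter_add (h := h)]
    simp_rw [quadraticForm_add_sub_polar, map_add, add_eq_zero_iff_eq_neg]
  rw [h1, card_eq_sum_card_fiberwise (f := Q)
    (t := {t | quadraticChar k (t - Q h) = quadraticChar k (Q h)})]
  · refine sum_congr rfl fun t ht => ?_
    congr 1
    ext u
    simp only [mem_filter, mem_univ, true_and] at ht ⊢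
    constructor
    · rintro ⟨⟨-, h2⟩, h3⟩
      exact ⟨h3, h2⟩
    · rintro ⟨rfl, h3⟩
      exact ⟨⟨ht, h3⟩, rfl⟩
  · intro u hu
    simp only [coe_filter, mem_univ, true_and, Set.mem_ofPred_eq] at hu ⊢
    exact hu.1

omit [Fintype V] in
include hk hQh in
theorem card_translate_quadraticChar_eq :
    (#{t : k | quadraticChar k (t - Q h) = quadraticChar k (Q h)} : ℚ)
      = (Fintype.card k - 1) / 2 := by
  rw [← card_quadraticChar_eq hk hQh, card_filter_add (h := Q h)]
  simp_rw [add_sub_cancel_right]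

include hψ hS hV hm hk hQh hD in
theorem card_definingSet :
    (#D : ℚ) = (Fintype.card k - 1) / 2
        * ((Fintype.card k : ℚ) ^ (2 * m - 1) + (Fintype.card k : ℚ) ^ m)
      - (1 + quadraticChar k (-1)) / 2 * (Fintype.card k : ℚ) ^ (m + 1) := by
  have h1 := card_filter_definingSet hD 0
  simp only [LinearMap.zero_apply, filter_true, neg_zero, and_true] at h1
  rw [h1, Nat.cast_sum]
  simp_rw [card_level_eq hψ hS hV hm, sum_sub_distrib, ← mul_sum, sum_const, nsmul_eq_mul,
    card_translate_quadraticChar_eq hk hQh]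
  rw [mul_comm ((1 + (quadraticChar k (-1) : ℚ)) / 2)]
  congr 2
  rw [sum_ite_eq']
  have h2 := quadraticChar_eq_neg_iff hQh
  simp only [mem_filter, mem_univ, true_and, zero_sub]
  rcases quadraticChar_dichotomy (neg_ne_zero.mpr (one_ne_zero (α := k))) with h' | h'
  · rw [if_pos (h2.mpr h').symm, h']
    norm_num
  · rw [if_neg (fun h3 => by rw [h2.mp h3.symm] at h'; norm_num at h'), h']
    norm_num

include hψ hS hV hm hk hQh hD in
-- Summing the root counts of Q(γ)v² - B(γ,h)v + t over the admissible t counts pairs (t, v); v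
-- determines t, so only a condition on v remains.
theorem card_filter_definingSet_polar {γ : V} (hγ : Q.polarBilin γ ≠ 0) :
    (#{x ∈ D | Q.polarBilin γ x = 0} : ℚ) = (Fintype.card k - 1) / 2
        * ((Fintype.card k : ℚ) ^ (2 * m - 2) + (Fintype.card k : ℚ) ^ m)
      - (Fintype.card k : ℚ) ^ m * quadraticCharCount (Q h) (Q γ) (Q.polarBilin h γ) := by
  rw [card_filter_definingSet hD, Nat.cast_sum]
  simp_rw [card_level_and_polar_eq hψ hS hV hm hγ, sum_sub_distrib, ← mul_sum, sum_const,
    nsmul_eq_mul, card_translate_quadraticChar_eq hk hQh]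
  congr 2
  rw [← Nat.cast_sum]
  congr 1
  simp_rw [card_filter]
  rw [sum_comm, quadraticCharCount, card_filter]
  -- The change v ↦ -v absorbs the sign of the linear coefficient -B(γ,h).
  refine Fintype.sum_equiv (Equiv.neg k) _ _ fun v => ?_
  rw [Equiv.neg_apply]
  have h1 : ∀ t : k, (Q γ * v ^ 2 + -Q.polarBilin γ h * v + t = 0)
      ↔ t = -(Q γ * v ^ 2 - Q.polarBilin h γ * v) := by
    intro t
    rw [show Q.polarBilin γ h = Q.polarBilin h γ by simp [QuadraticMap.polar_comm],
      add_eq_zero_iff_neg_eq, eq_comm]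
    ring_nf
  simp_rw [h1]
  rw [sum_ite_eq']
  simp only [mem_filter, mem_univ, true_and]
  refine if_congr ?_ rfl rfl
  rw [show -(Q γ * v ^ 2 - Q.polarBilin h γ * v) - Q h
    = -1 * (Q γ * (-v) ^ 2 + Q.polarBilin h γ * (-v) + Q h) by ring, map_mul, quadraticChar_neg' (Q h)]
  rcases quadraticChar_dichotomy (neg_ne_zero.mpr (one_ne_zero (α := k))) with h' | h' <;>
  rw [h']
  · simp only [one_mul]
  · constructor <;> intro h2 <;> linarith

include hψ hS hV hm hk hQh hD in
/-- The weight of the codeword of a functional given by the polar form. -/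
theorem card_filter_definingSet_polar_ne_zero {γ : V} (hγ : Q.polarBilin γ ≠ 0) :
    (#{x ∈ D | Q.polarBilin γ x ≠ 0} : ℚ)
      = ((Fintype.card k : ℚ) - 1) ^ 2 / 2 * (Fintype.card k : ℚ) ^ (2 * m - 2)
        + (Fintype.card k : ℚ) ^ m * (quadraticCharCount (Q h) (Q γ) (Q.polarBilin h γ)
          - (1 + quadraticChar k (-1)) / 2 * Fintype.card k) := by
  have h1 := card_definingSet hψ hS hV hm hk hQh hD
  rw [← card_filter_add_card_filter_not (s := D) (fun x => Q.polarBilin γ x = 0), Nat.cast_add,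
    card_filter_definingSet_polar hψ hS hV hm hk hQh hD hγ] at h1
  obtain ⟨n, rfl⟩ := Nat.exists_eq_succ_of_ne_zero hm
  rw [show 2 * n.succ - 2 = 2 * n by omega] at h1 ⊢
  rw [show 2 * n.succ - 1 = 2 * n + 1 by omega, Nat.succ_eq_add_one] at h1
  rw [Nat.succ_eq_add_one]
  linear_combination h1

include hk hD in
/-- The weight of the codeword of a functional not vanishing on the radical. -/
theorem card_filter_definingSet_ne_zero {f : V →ₗ[k] k} (hf : f ∉ Set.range Q.polarBilin) :
    (#{x ∈ D | f x ≠ 0} : ℚ) = (Fintype.card k - 1) / Fintype.card k * #D := by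
  obtain ⟨r, hr, hfr⟩ : ∃ r, Q.polarBilin r = 0 ∧ f r ≠ 0 := by
    by_contra! h1
    exact hf (QuadraticMap.exists_polarBilin_eq Q h1)
  have hQr : Q r = 0 := by
    have h1 := QuadraticMap.polar_self Q r
    rw [← QuadraticMap.polarBilin_apply_apply, hr] at h1
    simpa [Ring.two_ne_zero hk] using h1
  have hhr : Q.polarBilin h r = 0 := by
    have h1 : Q.polarBilin r h = 0 := by rw [hr]; rfl
    rwa [QuadraticMap.polarBilin_apply_apply, QuadraticMap.polar_comm] at h1
  have h2 := card_filter_linearMap_eq_zero (D := D) hfr fun v x => by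
    rw [hD, hD, QuadraticMap.map_add_smul, hr, hQr, map_add, map_smul, hhr]
    simp [-quadraticChar_apply]
  have h3 := card_filter_add_card_filter_not (s := D) (fun x => f x = 0)
  have h2' : (Fintype.card k : ℚ) * #{x ∈ D | f x = 0} = #D := by exact_mod_cast h2
  have h3' : (#{x ∈ D | f x = 0} : ℚ) + #{x ∈ D | ¬ f x = 0} = #D := by exact_mod_cast h3
  have hq : (Fintype.card k : ℚ) ≠ 0 := by simp
  field_simp
  linear_combination (Fintype.card k : ℚ) * h3' - h2'

include hψ hS hV hm hk hQh hD in
/-- The weight distribution of the code of all functionals on `D`, against a test function. -/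
theorem sum_weight_definingSet [Fintype (Module.Dual k V)] (g : ℚ → ℚ) :
    ∑ f : Module.Dual k V, g (#{x ∈ D | f x ≠ 0} : ℚ)
      = g 0 + ((Fintype.card k : ℚ) ^ (2 * m) - (Fintype.card k : ℚ) ^ (2 * m - 2))
          * g ((Fintype.card k - 1) / Fintype.card k * #D)
        + (∑ b : k, ∑ c : k, ((Fintype.card k : ℚ) ^ (2 * m - 2)
            - (Fintype.card k : ℚ) ^ m * quadraticChar k (c ^ 2 - 4 * b * Q h))
          * g (((Fintype.card k : ℚ) - 1) ^ 2 / 2 * (Fintype.card k : ℚ) ^ (2 * m - 2)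
            + (Fintype.card k : ℚ) ^ m * (quadraticCharCount (Q h) b c
              - (1 + quadraticChar k (-1)) / 2 * Fintype.card k))) / (Fintype.card k : ℚ) ^ 2
        - g (((Fintype.card k : ℚ) - 1) ^ 2 / 2 * (Fintype.card k : ℚ) ^ (2 * m - 2)) := by
  classical
  have h2 : (2 : k) ≠ 0 := Ring.two_ne_zero hk
  have hq : (Fintype.card k : ℚ) ≠ 0 := by simp
  set A : ℚ := ((Fintype.card k : ℚ) - 1) ^ 2 / 2 * (Fintype.card k : ℚ) ^ (2 * m - 2) with hA
  set G : k → k → ℚ := fun b c => g (A + (Fintype.card k : ℚ) ^ m *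
    (quadraticCharCount (Q h) b c - (1 + quadraticChar k (-1)) / 2 * Fintype.card k)) with hG
  set w : Module.Dual k V → ℚ := fun f => g (#{x ∈ D | f x ≠ 0} : ℚ) with hw
  have hker := card_ker_polarBilin hψ hS hV hk
  have hcard : #(univ.image Q.polarBilin : Finset (Module.Dual k V)) * Fintype.card k ^ 2
      = Fintype.card k ^ (2 * m) := by
    have h1 := sum_comp_linearMap_fiber Q.polarBilin (fun _ => 1)
    simp only [sum_const, card_univ, hV, hker, nsmul_eq_mul, mul_one] at h1
    rw [mul_comm]
    exact_mod_cast h1.symm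
  have hdual : Fintype.card (Module.Dual k V) = Fintype.card k ^ (2 * m) := by
    rw [← hV, Module.card_eq_pow_finrank (K := k), Module.card_eq_pow_finrank (K := k) (V := V),
      Subspace.dual_finrank_eq]
  have hout : ∑ f ∈ (univ.image Q.polarBilin)ᶜ, w f
      = ((Fintype.card k : ℚ) ^ (2 * m) - (Fintype.card k : ℚ) ^ (2 * m - 2))
          * g ((Fintype.card k - 1) / Fintype.card k * #D) := by
    rw [sum_congr rfl (g := fun _ => g ((Fintype.card k - 1) / Fintype.card k * #D)), sum_const,
      nsmul_eq_mul, card_compl, Nat.cast_sub (card_le_univ _), hdual, Nat.cast_pow]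
    · congr 2
      refine mul_right_cancel₀ (pow_ne_zero 2 hq) ?_
      rw [← pow_add, show 2 * m - 2 + 2 = 2 * m by omega]
      exact_mod_cast hcard
    · intro f hf
      simp only [hw]
      rw [card_filter_definingSet_ne_zero hk hD]
      simpa using hf
  have hin : (Fintype.card k : ℚ) ^ 2 * ∑ f ∈ univ.image Q.polarBilin, w f
      = ∑ γ, w (Q.polarBilin γ) := by
    rw [sum_comp_linearMap_fiber, hker, Nat.cast_pow]
  have hG0 : G 0 0 = g A := by
    simp [hG, quadraticCharCount_zero_zero hQh, -quadraticChar_apply]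
  have hrad : ∀ γ, Q.polarBilin γ = 0 → Q γ = 0 ∧ Q.polarBilin h γ = 0 := by
    intro γ hγ
    constructor
    · have h1 := QuadraticMap.polar_self Q γ
      rw [← QuadraticMap.polarBilin_apply_apply, hγ] at h1
      simpa [h2] using h1
    · have h1 : Q.polarBilin γ h = 0 := by rw [hγ]; rfl
      rwa [QuadraticMap.polarBilin_apply_apply, QuadraticMap.polar_comm] at h1
  -- The generic weight formula gives A instead of 0 when γ lies in the radical, hence the
  -- correction term.
  have hpt : ∀ γ, w (Q.polarBilin γ) = G (Q γ) (Q.polarBilin h γ)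
      + if Q.polarBilin γ = 0 then g 0 - g A else 0 := by
    intro γ
    split_ifs with h1
    · rw [(hrad γ h1).1, (hrad γ h1).2, hG0, h1]
      simp [hw]
    · simp only [hw, hG]
      rw [card_filter_definingSet_polar_ne_zero hψ hS hV hm hk hQh hD h1, add_zero]
  have hradsum : ∑ γ, (if Q.polarBilin γ = 0 then g 0 - g A else 0)
      = (Fintype.card k : ℚ) ^ 2 * (g 0 - g A) := by
    rw [← sum_filter, sum_const, nsmul_eq_mul, ← Nat.cast_pow, ← hker,
      Nat.card_eq_fintype_card, Fintype.card_subtype]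
    simp only [LinearMap.mem_ker]
  have hh : Q.polarBilin h ≠ 0 := by
    intro h1
    exact hQh (hrad h h1).1
  -- The pair (Q(γ), B(h,γ)) = (b, c) is counted by the roots of Q(h)v² + cv + b, of discriminant c²
  -- - 4bQ(h).
  have hGsum : ∑ γ, G (Q γ) (Q.polarBilin h γ) = ∑ b : k, ∑ c : k,
      ((Fintype.card k : ℚ) ^ (2 * m - 2)
        - (Fintype.card k : ℚ) ^ m * quadraticChar k (c ^ 2 - 4 * b * Q h)) * G b c := by
    rw [← Fintype.sum_prod_type (f := fun z : k × k => ((Fintype.card k : ℚ) ^ (2 * m - 2)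
        - (Fintype.card k : ℚ) ^ m * quadraticChar k (z.2 ^ 2 - 4 * z.1 * Q h)) * G z.1 z.2),
      ← sum_fiberwise_of_maps_to (t := univ) (g := fun γ => (Q γ, Q.polarBilin h γ))
        fun _ _ => mem_univ _]
    refine sum_congr rfl fun z _ => ?_
    rw [sum_congr rfl (g := fun _ => G z.1 z.2), sum_const, nsmul_eq_mul]
    · congr 1
      have h3 := card_roots_quadratic hk hQh z.2 z.1
      have h3' : (#{v : k | Q h * v ^ 2 + z.2 * v + z.1 = 0} : ℚ)
          = quadraticChar k (z.2 ^ 2 - 4 * Q h * z.1) + 1 := by exact_mod_cast h3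
      have h4 := card_level_and_polar_eq hψ hS hV hm hh z.1 z.2
      rw [h3', show z.2 ^ 2 - 4 * Q h * z.1 = z.2 ^ 2 - 4 * z.1 * Q h by ring] at h4
      simp_rw [Prod.ext_iff]
      rw [h4]
      ring
    · intro γ hγ
      rw [← (mem_filter.mp hγ).2]
  rw [← sum_compl_add_sum (univ.image Q.polarBilin), hout]
  simp_rw [hpt, sum_add_distrib, hradsum, hGsum] at hin
  have hin' := (eq_div_iff (pow_ne_zero 2 hq)).mpr ((mul_comm _ _).trans hin)
  rw [hin', add_div, mul_div_cancel_left₀ _ (pow_ne_zero 2 hq)]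
  ring

end

end QuadraticFormCodes

/-! ### From test-function sums to weight tables -/

section WeightTables

variable {p : ℕ} {ι : Type*} [Fintype ι] {F : Type*} [Field F] [Fintype F] [Algebra (ZMod p) F]

/-- A linear encoding whose weights are distributed as in a table with a single row of weight zero
is injective. -/
theorem injective_of_sum_weight {φ : F →ₗ[ZMod p] (ι → ZMod p)} {T : List (ℚ × ℚ)}
    (hT : ∀ r ∈ T, r.1 ≠ 0)
    (h : ∀ g : ℚ → ℚ, ∑ a, g (hammingNorm (φ a))
      = g 0 + (T.map fun r => r.2 * g r.1).sum) : Function.Injective φ := by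
  classical
  -- The indicator of weight zero counts the kernel.
  have h1 := h fun w => if w = 0 then 1 else 0
  have h2 : (T.map fun r => r.2 * if r.1 = 0 then (1 : ℚ) else 0).sum = 0 := by
    refine List.sum_eq_zero fun x hx => ?_
    obtain ⟨r, hr, rfl⟩ := List.mem_map.mp hx
    simp [hT r hr]
  rw [h2, sum_boole, if_pos rfl, add_zero] at h1
  have h3 : #{a : F | (hammingNorm (φ a) : ℚ) = 0} = 1 := by exact_mod_cast h1
  obtain ⟨b, hb⟩ := card_eq_one.mp h3
  have h4 : ∀ a, φ a = 0 → a = b := fun a ha => by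
    rw [← mem_singleton, ← hb]
    simp [ha]
  refine (injective_iff_map_eq_zero φ).mpr fun a ha => ?_
  rw [h4 a ha, h4 0 (map_zero φ)]

theorem hasWeightTable_of_sum_weight {φ : F →ₗ[ZMod p] (ι → ZMod p)} {T : List (ℚ × ℚ)}
    (hφ : Function.Injective φ)
    (h : ∀ g : ℚ → ℚ, ∑ a, g (hammingNorm (φ a)) = (T.map fun r => r.2 * g r.1).sum) :
    HasWeightTable (LinearMap.range φ) T := by
  classical
  intro w
  have h1 := h fun x => if x = w then 1 else 0
  rw [sum_boole] at h1
  have h2 : {c : ι → ZMod p | c ∈ LinearMap.range φ ∧ (hammingNorm c : ℚ) = w}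
      = φ '' ({a : F | (hammingNorm (φ a) : ℚ) = w} : Finset F) := by
    ext c
    simp only [Set.mem_ofPred_eq, LinearMap.mem_range, Set.mem_image, mem_coe, mem_filter,
      mem_univ, true_and]
    constructor
    · rintro ⟨⟨a, rfl⟩, ha⟩
      exact ⟨a, ha, rfl⟩
    · rintro ⟨a, ha, rfl⟩
      exact ⟨⟨a, rfl⟩, ha⟩
  rw [weightCount, h2, Set.ncard_image_of_injective _ hφ, Set.ncard_coe_finset, h1]
  congr 2
  ext r
  simp

theorem numNonzeroWeights_le {C : Submodule (ZMod p) (ι → ZMod p)} {c : ℚ}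
    {T : List (ℚ × ℚ)} (h : HasWeightTable C ((0, c) :: T)) :
    numNonzeroWeights C ≤ T.length := by
  classical
  have h1 : numNonzeroWeights C ≤ #(T.map Prod.fst).toFinset := by
    refine card_le_card_of_injOn (fun w : ℕ => (w : ℚ)) ?_ (Nat.cast_injective.injOn)
    intro w hw
    simp only [coe_filter, mem_Icc, Set.mem_ofPred_eq] at hw
    simp only [mem_coe, List.mem_toFinset]
    by_contra hT
    have h2 := h (w : ℚ)
    have hw0 : (0 : ℚ) ≠ w := by
      have := hw.1.1
      exact_mod_cast (show 0 ≠ w by omega)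
    rw [List.map_cons, List.sum_cons, if_neg hw0, zero_add, List.sum_eq_zero] at h2
    · exact hw.2 (by exact_mod_cast h2)
    · intro x hx
      obtain ⟨r, hr, rfl⟩ := List.mem_map.mp hx
      refine if_neg fun hr' => hT ?_
      exact hr' ▸ List.mem_map_of_mem hr
  exact h1.trans ((List.toFinset_card_le _).trans (by simp))

end WeightTables

/-! ### The trace code over the prime field -/

theorem hammingNorm_codewordMap (p : ℕ) {F : Type*} [Field F] [Algebra (ZMod p) F] (D : Finset F)
    (a : F) : hammingNorm (codewordMap p D a) = #{x ∈ D | Algebra.trace (ZMod p) F (a * x) ≠ 0} := by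
  rw [hammingNorm, card_filter, card_filter, ← sum_coe_sort D]
  rfl

section

variable {p : ℕ} [Fact p.Prime] {F : Type*} [Field F] [Fintype F]
  [Algebra (ZMod p) F] {n : ℕ} (hF : Fintype.card F = p ^ (2 * (n + 2)))

theorem mem_cyclotomicClass_iff {i : Fin 2} {d : ZMod p}
    (hd : quadraticChar (ZMod p) d = (-1) ^ (i : ℕ)) (y : ZMod p) :
    y ∈ cyclotomicClass p i ↔ quadraticChar (ZMod p) y = quadraticChar (ZMod p) d := by
  rw [hd]
  by_cases hy : y = 0
  · subst hy
    simp only [cyclotomicClass, Set.mem_ofPred_eq, ne_eq, not_true_eq_false, false_and, false_iff,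
      MulChar.map_zero]
    exact (pow_ne_zero _ (by norm_num)).symm
  · have h1 := quadraticChar_one_iff_isSquare hy
    have h2 := quadraticChar_neg_one_iff_not_isSquare (a := y)
    simp only [cyclotomicClass, Set.mem_ofPred_eq, ne_eq, hy, not_false_eq_true, true_and]
    fin_cases i
    · simp [h1, -quadraticChar_apply]
    · simp [h2, -quadraticChar_apply]

include hF in
theorem finrank_eq_of_card_eq : Module.finrank (ZMod p) F = 2 * (n + 2) := by
  have h := Module.card_eq_pow_finrank (K := ZMod p) (V := F)
  rw [ZMod.card, hF] at h
  exact (Nat.pow_right_injective (Fact.out : p.Prime).two_le h).symm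

/-- Frobenius fixes 1/2, so both terms of the polar form equal Tr(x)/2. -/
theorem polarBilin_hermitianTraceForm_half (hp : p ≠ 2) (x : F) :
    (hermitianTraceForm (ZMod p) F).polarBilin (algebraMap (ZMod p) F 2⁻¹) x
      = Algebra.trace (ZMod p) F x := by
  have h2 : (2 : ZMod p) ≠ 0 := Ring.two_ne_zero (by rwa [ZMod.ringChar_zmod_n])
  have h3 := trace_pow_card (k := ZMod p) x
  rw [ZMod.card] at h3
  rw [polarBilin_hermitianTraceForm, ZMod.card, ← map_pow, ZMod.pow_card, mul_comm (x ^ p),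
    ← Algebra.smul_def, ← Algebra.smul_def, map_smul, map_smul, h3, ← two_smul (ZMod p),
    smul_smul, mul_inv_cancel₀ h2, one_smul]

include hF in
-- The value is e/4, since (1/2)^(p+1) = 1/4 in the prime field, and 4 is a square.
theorem quadraticChar_hermitianTraceForm_half (hp : p ≠ 2) {i : Fin 2}
    (hi : legendreSym p ((2 * (n + 2) : ℕ) : ℤ) = (-1) ^ (i : ℕ)) :
    quadraticChar (ZMod p) (hermitianTraceForm (ZMod p) F (algebraMap (ZMod p) F 2⁻¹))
      = (-1) ^ (i : ℕ) := by
  have h2 : (2 : ZMod p) ≠ 0 := Ring.two_ne_zero (by rwa [ZMod.ringChar_zmod_n])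
  have h3 : (2⁻¹ : ZMod p) ^ (p + 1) = 2⁻¹ ^ 2 := by
    rw [pow_succ, ZMod.pow_card, sq]
  rw [hermitianTraceForm_apply, ZMod.card, ← map_pow, h3, Algebra.trace_algebraMap,
    finrank_eq_of_card_eq hF, nsmul_eq_mul, map_mul, quadraticChar_sq_one' (inv_ne_zero h2), mul_one,
    ← hi, legendreSym]
  simp

include hF in
theorem card_definingSet_and_sum_weight (hp : p ≠ 2) (hn : Even n) {i : Fin 2}
    (hi : legendreSym p ((2 * (n + 2) : ℕ) : ℤ) = (-1) ^ (i : ℕ)) :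
    ((#(definingSet p F i) : ℕ) : ℚ) = (p - 1) / 2 * ((p : ℚ) ^ (2 * n + 3) + (p : ℚ) ^ (n + 2))
        - (1 + quadraticChar (ZMod p) (-1)) / 2 * (p : ℚ) ^ (n + 3) ∧
    ∀ g G : ℚ → ℚ, (∀ w, G w = g (((p : ℚ) - 1) ^ 2 / 2 * (p : ℚ) ^ (2 * n + 2)
        + (p : ℚ) ^ (n + 2) * (w - (1 + quadraticChar (ZMod p) (-1)) / 2 * p))) →
      ∑ a, g (hammingNorm (codewordMap p (definingSet p F i) a))
      = g 0 + ((p : ℚ) ^ (2 * n + 4) - (p : ℚ) ^ (2 * n + 2))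
          * g (((p : ℚ) - 1) / p * #(definingSet p F i))
        + ((p : ℚ) ^ (2 * n + 2) * G ((1 + quadraticChar (ZMod p) (-1)) / 2 * p)
          + (p - 1) * ((p : ℚ) ^ (2 * n + 2) - (p : ℚ) ^ (n + 2)) * G ((p - 1) / 2)
          + (p - 1) / 2 * (
            2 * (p : ℚ) ^ (2 * n + 2) * G ((1 + quadraticChar (ZMod p) (-1)) / 2 * (p - 1))
            + (p - 3) / 2 * ((p : ℚ) ^ (2 * n + 2) - (p : ℚ) ^ (n + 2))
              * G ((p - 2 - quadraticChar (ZMod p) (-1)) / 2)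
            + (p - 1) / 2 * ((p : ℚ) ^ (2 * n + 2) - (p : ℚ) ^ (n + 2))
              * G ((p - 2 + quadraticChar (ZMod p) (-1)) / 2)
            + (p - 1) / 2 * ((p : ℚ) ^ (2 * n + 2) + (p : ℚ) ^ (n + 2))
              * G ((p - quadraticChar (ZMod p) (-1)) / 2)
            + (p + 1) / 2 * ((p : ℚ) ^ (2 * n + 2) + (p : ℚ) ^ (n + 2))
              * G ((p + quadraticChar (ZMod p) (-1)) / 2))) / (p : ℚ) ^ 2
        - g (((p : ℚ) - 1) ^ 2 / 2 * (p : ℚ) ^ (2 * n + 2)) := by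
  classical
  have hk : ringChar (ZMod p) ≠ 2 := by rwa [ZMod.ringChar_zmod_n]
  have hη := quadraticChar_hermitianTraceForm_half hF hp hi
  set h : F := algebraMap (ZMod p) F 2⁻¹ with hh
  have hm : Even (n + 2) := hn.add even_two
  have hV : Fintype.card F = Fintype.card (ZMod p) ^ (2 * (n + 2)) := by rw [hF, ZMod.card]
  have hψ := AddChar.FiniteField.primitiveChar_to_Complex_isPrimitive (ZMod p)
  have hS := fun z hz => sum_addChar_hermitianTraceForm (F := F) hm hV hk hψ (z := z) hz
  have hQh : hermitianTraceForm (ZMod p) F h ≠ 0 := by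
    intro h0
    rw [h0, MulChar.map_zero] at hη
    exact pow_ne_zero _ (by norm_num) hη.symm
  have hD : ∀ x, x ∈ definingSet p F i ↔ quadraticChar (ZMod p) (hermitianTraceForm (ZMod p) F x
      - (hermitianTraceForm (ZMod p) F).polarBilin h x)
        = quadraticChar (ZMod p) (hermitianTraceForm (ZMod p) F h) := by
    intro x
    rw [← mem_cyclotomicClass_iff hη, polarBilin_hermitianTraceForm_half hp,
      hermitianTraceForm_apply, ZMod.card, ← map_sub]
    simp [definingSet]
  have hcard := card_definingSet hψ hS hV (by omega) hk hQh hD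
  -- The trace form identifies a with the functional Tr(a·); the same identification reindexes the
  -- final sum.
  let _ : Fintype (Module.Dual (ZMod p) F) :=
    Fintype.ofEquiv F (LinearMap.BilinForm.toDual (Algebra.traceForm (ZMod p) F)
      (traceForm_nondegenerate (ZMod p) F)).toEquiv
  have hsum := sum_weight_definingSet hψ hS hV (by omega) hk hQh hD
  rw [ZMod.card] at hcard
  simp only [ZMod.card] at hsum
  rw [show 2 * (n + 2) - 1 = 2 * n + 3 by omega] at hcard
  simp only [show 2 * (n + 2) = 2 * n + 4 by omega,
    show 2 * n + 4 - 2 = 2 * n + 2 by omega] at hsum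
  refine ⟨hcard, fun g G hG => ?_⟩
  have hsumc := sum_quadraticCharCount hk hQh ((p : ℚ) ^ (2 * n + 2)) ((p : ℚ) ^ (n + 2)) G
  rw [ZMod.card] at hsumc
  rw [← hsumc]
  simp_rw [hG]
  rw [← hsum g]
  refine Fintype.sum_equiv (LinearMap.BilinForm.toDual (Algebra.traceForm (ZMod p) F)
      (traceForm_nondegenerate (ZMod p) F)).toEquiv _ _ fun a => ?_
  rw [hammingNorm_codewordMap]
  rfl

end

section

variable {p : ℕ} [Fact p.Prime] {F : Type*} [Field F] [Fintype F]
  [Algebra (ZMod p) F] {n : ℕ} (hF : Fintype.card F = p ^ (2 * (n + 2)))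

theorem quadraticChar_neg_one_of_mod_four_eq_one (h : p % 4 = 1) :
    quadraticChar (ZMod p) (-1) = 1 := by
  rw [quadraticChar_neg_one (by rw [ZMod.ringChar_zmod_n]; rintro rfl; omega), ZMod.card,
    ZMod.χ₄_nat_one_mod_four h]

theorem quadraticChar_neg_one_of_mod_four_eq_three (h : p % 4 = 3) :
    quadraticChar (ZMod p) (-1) = -1 := by
  rw [quadraticChar_neg_one (by rw [ZMod.ringChar_zmod_n]; rintro rfl; omega), ZMod.card,
    ZMod.χ₄_nat_three_mod_four h]

include hF in
theorem sum_weight_of_mod_four_eq_one (hp : p % 4 = 1) (hn : Even n) {i : Fin 2}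
    (hi : legendreSym p ((2 * (n + 2) : ℕ) : ℤ) = (-1) ^ (i : ℕ)) (g : ℚ → ℚ) :
    ∑ a, g (hammingNorm (codewordMap p (definingSet p F i) a))
      = ((tableOne p (2 * (n + 2))).map fun r => r.2 * g r.1).sum := by
  have hp0 : (p : ℚ) ≠ 0 := by
    rw [Nat.cast_ne_zero]
    rintro rfl
    omega
  obtain ⟨h1, h2⟩ := card_definingSet_and_sum_weight hF (by rintro rfl; omega) hn hi
  rw [h2 g _ fun w => rfl, h1, quadraticChar_neg_one_of_mod_four_eq_one hp]
  simp only [tableOne, List.map_cons, List.map_nil, List.sum_cons, List.sum_nil,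
    show 2 * (n + 2) = 2 * n + 4 by omega, show 2 * n + 4 - 2 = 2 * n + 2 by omega,
    show (2 * n + 4) / 2 = n + 2 by omega, show 2 * n + 4 - 4 = 2 * n by omega,
    show n + 2 - 1 = n + 1 by omega, show n + 2 - 2 = n by omega]
  set A : ℚ := ((p : ℚ) - 1) ^ 2 / 2 * (p : ℚ) ^ (2 * n + 2) with hA
  -- The weights of `e3`, `e6` and `e7` coincide, so their three multiplicities add up to one row.
  have e1 : ((p : ℚ) - 1) / p * ((p - 1) / 2 * ((p : ℚ) ^ (2 * n + 3) + (p : ℚ) ^ (n + 2))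
      - (1 + ((1 : ℤ) : ℚ)) / 2 * (p : ℚ) ^ (n + 3))
      = A - ((p : ℚ) ^ 2 - 1) / 2 * (p : ℚ) ^ (n + 1) := by
    rw [hA]; field_simp; push_cast; ring
  have e2 : A + (p : ℚ) ^ (n + 2) * ((1 + ((1 : ℤ) : ℚ)) / 2 * p - (1 + ((1 : ℤ) : ℚ)) / 2 * p)
      = A := by ring
  have e3 : A + (p : ℚ) ^ (n + 2) * ((p - 1) / 2 - (1 + ((1 : ℤ) : ℚ)) / 2 * p)
      = A - ((p : ℚ) + 1) / 2 * (p : ℚ) ^ (n + 2) := by push_cast; ring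
  have e4 : A + (p : ℚ) ^ (n + 2) * ((1 + ((1 : ℤ) : ℚ)) / 2 * (p - 1)
      - (1 + ((1 : ℤ) : ℚ)) / 2 * p) = A - (p : ℚ) ^ (n + 2) := by push_cast; ring
  have e5 : A + (p : ℚ) ^ (n + 2) * ((p - 2 - ((1 : ℤ) : ℚ)) / 2 - (1 + ((1 : ℤ) : ℚ)) / 2 * p)
      = A - ((p : ℚ) + 3) / 2 * (p : ℚ) ^ (n + 2) := by push_cast; ring
  have e6 : A + (p : ℚ) ^ (n + 2) * ((p - 2 + ((1 : ℤ) : ℚ)) / 2 - (1 + ((1 : ℤ) : ℚ)) / 2 * p)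
      = A - ((p : ℚ) + 1) / 2 * (p : ℚ) ^ (n + 2) := by push_cast; ring
  have e7 : A + (p : ℚ) ^ (n + 2) * ((p - ((1 : ℤ) : ℚ)) / 2 - (1 + ((1 : ℤ) : ℚ)) / 2 * p)
      = A - ((p : ℚ) + 1) / 2 * (p : ℚ) ^ (n + 2) := by push_cast; ring
  have e8 : A + (p : ℚ) ^ (n + 2) * ((p + ((1 : ℤ) : ℚ)) / 2 - (1 + ((1 : ℤ) : ℚ)) / 2 * p)
      = A - ((p : ℚ) - 1) / 2 * (p : ℚ) ^ (n + 2) := by push_cast; ring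
  rw [e1, e2, e3, e4, e5, e6, e7, e8]
  field_simp
  ring

include hF in
theorem sum_weight_of_mod_four_eq_three (hp : p % 4 = 3) (hn : Even n) {i : Fin 2}
    (hi : legendreSym p ((2 * (n + 2) : ℕ) : ℤ) = (-1) ^ (i : ℕ)) (g : ℚ → ℚ) :
    ∑ a, g (hammingNorm (codewordMap p (definingSet p F i) a))
      = ((tableThree p (2 * (n + 2))).map fun r => r.2 * g r.1).sum := by
  have hp0 : (p : ℚ) ≠ 0 := by
    rw [Nat.cast_ne_zero]
    rintro rfl
    omega
  obtain ⟨h1, h2⟩ := card_definingSet_and_sum_weight hF (by rintro rfl; omega) hn hi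
  rw [h2 g _ fun w => rfl, h1, quadraticChar_neg_one_of_mod_four_eq_three hp]
  simp only [tableThree, List.map_cons, List.map_nil, List.sum_cons, List.sum_nil,
    show 2 * (n + 2) = 2 * n + 4 by omega, show 2 * n + 4 - 2 = 2 * n + 2 by omega,
    show (2 * n + 4) / 2 = n + 2 by omega, show 2 * n + 4 - 4 = 2 * n by omega,
    show n + 2 - 1 = n + 1 by omega, show n + 2 - 2 = n by omega,
    show 2 * n + 4 - 3 = 2 * n + 1 by omega]
  set A : ℚ := ((p : ℚ) - 1) ^ 2 / 2 * (p : ℚ) ^ (2 * n + 2) with hA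
  -- Here `e2` and `e4` share the weight A, and `e3`, `e5` and `e8` share another.
  have e1 : ((p : ℚ) - 1) / p * ((p - 1) / 2 * ((p : ℚ) ^ (2 * n + 3) + (p : ℚ) ^ (n + 2))
      - (1 + ((-1 : ℤ) : ℚ)) / 2 * (p : ℚ) ^ (n + 3))
      = A + ((p : ℚ) - 1) ^ 2 / 2 * (p : ℚ) ^ (n + 1) := by
    rw [hA]; field_simp; push_cast; ring
  have e2 : A + (p : ℚ) ^ (n + 2) * ((1 + ((-1 : ℤ) : ℚ)) / 2 * p
      - (1 + ((-1 : ℤ) : ℚ)) / 2 * p) = A := by ring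
  have e3 : A + (p : ℚ) ^ (n + 2) * ((p - 1) / 2 - (1 + ((-1 : ℤ) : ℚ)) / 2 * p)
      = A + ((p : ℚ) - 1) / 2 * (p : ℚ) ^ (n + 2) := by push_cast; ring
  have e4 : A + (p : ℚ) ^ (n + 2) * ((1 + ((-1 : ℤ) : ℚ)) / 2 * (p - 1)
      - (1 + ((-1 : ℤ) : ℚ)) / 2 * p) = A := by push_cast; ring
  have e5 : A + (p : ℚ) ^ (n + 2) * ((p - 2 - ((-1 : ℤ) : ℚ)) / 2
      - (1 + ((-1 : ℤ) : ℚ)) / 2 * p) = A + ((p : ℚ) - 1) / 2 * (p : ℚ) ^ (n + 2) := by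
    push_cast; ring
  have e6 : A + (p : ℚ) ^ (n + 2) * ((p - 2 + ((-1 : ℤ) : ℚ)) / 2
      - (1 + ((-1 : ℤ) : ℚ)) / 2 * p) = A + ((p : ℚ) - 3) / 2 * (p : ℚ) ^ (n + 2) := by
    push_cast; ring
  have e7 : A + (p : ℚ) ^ (n + 2) * ((p - ((-1 : ℤ) : ℚ)) / 2 - (1 + ((-1 : ℤ) : ℚ)) / 2 * p)
      = A + ((p : ℚ) + 1) / 2 * (p : ℚ) ^ (n + 2) := by push_cast; ring
  have e8 : A + (p : ℚ) ^ (n + 2) * ((p + ((-1 : ℤ) : ℚ)) / 2 - (1 + ((-1 : ℤ) : ℚ)) / 2 * p)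
      = A + ((p : ℚ) - 1) / 2 * (p : ℚ) ^ (n + 2) := by push_cast; ring
  rw [e1, e2, e3, e4, e5, e6, e7, e8]
  field_simp
  ring

end

/-! ### Nonvanishing of the listed weights and the main theorem -/

/-- The largest amount subtracted is (p+3)/2 · p^(e/2). The main term is at least (p-1)²/2 · p^(e/2)
because e ≥ 4, and p + 3 < (p-1)² from p = 5 on. -/
theorem tableOne_weight_ne_zero {p n : ℕ} (hp : 5 ≤ p) :
    ∀ r ∈ (tableOne p (2 * (n + 2))).tail, r.1 ≠ 0 := by
  have hp5 : (5 : ℚ) ≤ p := by exact_mod_cast hp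
  simp only [tableOne, List.tail_cons, List.forall_mem_cons,
    show 2 * (n + 2) - 2 = 2 * n + 2 by omega, show 2 * (n + 2) / 2 = n + 2 by omega,
    show n + 2 - 1 = n + 1 by omega, List.not_mem_nil, false_imp_iff, implies_true, and_true]
  have hP : (1 : ℚ) ≤ (p : ℚ) ^ n := one_le_pow₀ (by linarith)
  have hA : ((p : ℚ) - 1) ^ 2 / 2 * (p : ℚ) ^ (n + 2)
      ≤ ((p : ℚ) - 1) ^ 2 / 2 * (p : ℚ) ^ (2 * n + 2) :=
    mul_le_mul_of_nonneg_left (pow_le_pow_right₀ (by linarith) (by omega)) (by positivity)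
  have hQ : (0 : ℚ) < (p : ℚ) ^ (n + 2) := by positivity
  have hQ1 : (0 : ℚ) < (p : ℚ) ^ (n + 1) := by positivity
  have hQ2 : (p : ℚ) ^ (n + 2) = (p : ℚ) ^ (n + 1) * p := pow_succ _ _
  have key : ((p : ℚ) + 3) / 2 * (p : ℚ) ^ (n + 2)
      < ((p : ℚ) - 1) ^ 2 / 2 * (p : ℚ) ^ (n + 2) :=
    mul_lt_mul_of_pos_right (by nlinarith) hQ
  refine ⟨?_, ?_, ?_, ?_, ?_, ?_⟩ <;> apply ne_of_gt <;> nlinarith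

theorem tableThree_weight_ne_zero {p n : ℕ} (hp : 3 ≤ p) :
    ∀ r ∈ (tableThree p (2 * (n + 2))).tail, r.1 ≠ 0 := by
  have hp3 : (3 : ℚ) ≤ p := by exact_mod_cast hp
  have h0 : (0 : ℚ) < (p : ℚ) - 1 := by linarith
  have h1 : (0 : ℚ) ≤ (p : ℚ) - 3 := by linarith
  simp only [tableThree, List.tail_cons, List.forall_mem_cons, List.not_mem_nil, false_imp_iff,
    implies_true, and_true]
  refine ⟨?_, ?_, ?_, ?_, ?_⟩ <;> positivity

theorem theorem8 (p : ℕ) [Fact p.Prime] (hp : p ≠ 2) (e : ℕ) (he : 0 < e) (he4 : e % 4 = 0)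
    (F : Type*) [Field F] [Fintype F] [Algebra (ZMod p) F] (hF : Fintype.card F = p ^ e)
    (i : Fin 2) (hi : legendreSym p (e : ℤ) = (-1) ^ (i : ℕ)) :
    ((definingSet p F i).card : ℚ) =
        ((p : ℚ) - 1) / 2 * (p : ℚ) ^ (e - 1)
          - (1 + (quadraticChar (ZMod p) (-1) : ℚ) * (p : ℚ)) / 2 * (p : ℚ) ^ (e / 2) ∧
      Module.finrank (ZMod p) (traceCode p (definingSet p F i)) = e ∧
      numNonzeroWeights (traceCode p (definingSet p F i)) ≤ 6 ∧
      (p % 4 = 1 → HasWeightTable (traceCode p (definingSet p F i)) (tableOne p e)) ∧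
      (p % 4 = 3 → HasWeightTable (traceCode p (definingSet p F i)) (tableThree p e)) := by

  -- With e = 2(n+2), the truncated exponents e - 4 and e/2 - 2 become 2n and n.
  obtain ⟨n, hn, rfl⟩ : ∃ n, Even n ∧ e = 2 * (n + 2) := by
    obtain ⟨l, rfl⟩ := Nat.dvd_of_mod_eq_zero he4
    obtain ⟨j, rfl⟩ := Nat.exists_eq_succ_of_ne_zero (show l ≠ 0 by omega)
    exact ⟨2 * j, even_two_mul j, by rw [Nat.succ_eq_add_one]; ring⟩
  have hp2 := (Fact.out : p.Prime).two_le
  have hodd := (Fact.out : p.Prime).eq_two_or_odd.resolve_left hp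
  have hcard := (card_definingSet_and_sum_weight hF hp hn hi).1
  have hcases : p % 4 = 1 ∨ p % 4 = 3 := by omega
  have h1 : p % 4 = 1 → Function.Injective (codewordMap p (definingSet p F i)) ∧
      HasWeightTable (traceCode p (definingSet p F i)) (tableOne p (2 * (n + 2))) := by
    intro h
    have hs := sum_weight_of_mod_four_eq_one hF h hn hi
    have hinj := injective_of_sum_weight (tableOne_weight_ne_zero (n := n)
      (show 5 ≤ p by omega)) fun g => by
        rw [hs g]
        simp [tableOne]
    exact ⟨hinj, hasWeightTable_of_sum_weight hinj hs⟩
  have h3 : p % 4 = 3 → Function.Injective (codewordMap p (definingSet p F i)) ∧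
      HasWeightTable (traceCode p (definingSet p F i)) (tableThree p (2 * (n + 2))) := by
    intro h
    have hs := sum_weight_of_mod_four_eq_three hF h hn hi
    have hinj := injective_of_sum_weight (tableThree_weight_ne_zero (n := n)
      (show 3 ≤ p by omega)) fun g => by
        rw [hs g]
        simp [tableThree]
    exact ⟨hinj, hasWeightTable_of_sum_weight hinj hs⟩
  refine ⟨?_, ?_, ?_, fun h => (h1 h).2, fun h => (h3 h).2⟩
  · rw [hcard, show 2 * (n + 2) - 1 = 2 * n + 3 by omega, show 2 * (n + 2) / 2 = n + 2 by omega]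
    ring
  · rw [traceCode, LinearMap.finrank_range_of_inj (hcases.elim (fun h => (h1 h).1)
      fun h => (h3 h).1), finrank_eq_of_card_eq hF]
  · rcases hcases with h | h
    · exact numNonzeroWeights_le (h1 h).2
    · exact (numNonzeroWeights_le (h3 h).2).trans (by simp)
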